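/- Let $d\ge 6$ and let $\mathcal T_d$ be the $d$-regular (unrooted) tree. For a vertex $v$ let $E(v)$ be the set of edges containing $v$. Fix a coloring, i.e. a map $c:E\mathcal T_d\to [d]=\{0,\dots,d-1\}$ whose restriction $c_v$ to $E(v)$ is a bijection onto $[d]$ for every vertex $v$. For $g\in\mathrm{Aut}(\mathcal T_d)$ let $g_v:E(v)\to E(g.v)$ be the bijection induced by $g$. For a subgroup $F$ of the symmetric group $\mathfrak S_d$ of $[d]$ put $$U(F)=\{g\in \mathrm{Aut}(\mathcal T_d)\mid c_{g.v}\circ g_v\circ c_v^{-1}\in F\text{ for all vertices }v\},$$ and let $U(F)^+$ be the subgroup generated by the pointwise stabilizers in $U(F)$ of the edges of $\mathcal T_d$, with the topology of pointwise convergence on vertices. Suppose that $F$ is perfect, $2$-transitive on $[d]$ and generated by its point stabilizers, and that the point stabilizers of $F$ are perfect. Then: 1. (countable index property) every subgroup of countable index in $U(F)^+$ is open; 2. (invariant automatic continuity property) every group homomorphism from $U(F)^+$ to a Polish group whose identity has a neighborhood basis of conjugation invariant sets is continuous; 3. (locally compact automatic continuity property) every group homomorphism from $U(F)^+$ to a locally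 compact Polish group is continuous. -/

import Mathlib

open Topology

universe u v

/-! ### Automatic continuity properties of topological groups -/

/-- A topological group is a *small invariant neighborhood* (SIN) group if the identity has a
neighborhood basis consisting of conjugation invariant sets. -/
def IsSINGroup (H : Type*) [Group H] [TopologicalSpace H] : Prop :=
  ∀ U ∈ 𝓝 (1 : H), ∃ W ∈ 𝓝 (1 : H), W ⊆ U ∧ ∀ g : H, ∀ x ∈ W, g * x * g⁻¹ ∈ W

/-- The countable index property: every subgroup of countable (possibly finite) index is open. -/
def CountableIndexProperty (G : Type*) [Group G] [TopologicalSpace G] : Prop :=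
  ∀ K : Subgroup G, Countable (G ⧸ K) → IsOpen (K : Set G)

/-- The invariant automatic continuity property: every homomorphism into a SIN Polish group is
continuous. -/
def InvariantAutomaticContinuityProperty (G : Type u) [Group G] [TopologicalSpace G] :
    Prop :=
  ∀ (H : Type v) [Group H] [TopologicalSpace H] [IsTopologicalGroup H] [PolishSpace H],
    IsSINGroup H → ∀ ψ : G →* H, Continuous ψ

/-- The locally compact automatic continuity property: every homomorphism into a locally compact
Polish group is continuous. -/
def LocallyCompactAutomaticContinuityProperty (G : Type u) [Group G]
    [TopologicalSpace G] : Prop :=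
  ∀ (H : Type v) [Group H] [TopologicalSpace H] [IsTopologicalGroup H] [PolishSpace H]
    [LocallyCompactSpace H], ∀ ψ : G →* H, Continuous ψ

/-! ### The automorphism group of a graph as a topological group -/

namespace BurgerMozes

/-- The topology of pointwise convergence on the automorphism group of a graph, where the vertex
set is discrete: the pointwise stabilizers of finite sets of vertices form a basis at `1`. -/
instance autTopology {V : Type*} (T : SimpleGraph V) : TopologicalSpace (T ≃g T) :=
  TopologicalSpace.induced (fun (g : T ≃g T) (v : V) => g v)
    (@Pi.topologicalSpace V (fun _ => V) (fun _ => ⊥))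

theorem isOpen_apply_eq {V : Type*} (T : SimpleGraph V) (v w : V) :
    IsOpen {g : T ≃g T | g v = w} := by
  let _ : TopologicalSpace V := ⊥
  have _ : DiscreteTopology V := ⟨rfl⟩
  have h : Continuous (fun g : T ≃g T => g v) :=
    (continuous_apply v).comp continuous_induced_dom
  exact (isOpen_discrete {w}).preimage h

theorem continuous_iff_isOpen_apply {V X : Type*} [TopologicalSpace X] (T : SimpleGraph V)
    (f : X → (T ≃g T)) : Continuous f ↔ ∀ v w : V, IsOpen {x | f x v = w} := by
  constructor
  · intro h v w
    exact (isOpen_apply_eq T v w).preimage h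
  · intro h
    let _ : TopologicalSpace V := ⊥
    have _ : DiscreteTopology V := ⟨rfl⟩
    refine continuous_induced_rng.2 (continuous_pi fun v => ?_)
    exact continuous_discrete_rng.2 fun w => h v w

instance autIsTopologicalGroup {V : Type*} (T : SimpleGraph V) :
    IsTopologicalGroup (T ≃g T) where
  continuous_mul := by
    rw [continuous_iff_isOpen_apply]
    intro v w
    have : {p : (T ≃g T) × (T ≃g T) | (p.1 * p.2) v = w}
        = ⋃ u : V, {g : T ≃g T | g u = w} ×ˢ {g : T ≃g T | g v = u} := by
      ext p
      simp
    rw [this]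
    exact isOpen_iUnion fun u => (isOpen_apply_eq T u w).prod (isOpen_apply_eq T v u)
  continuous_inv := by
    rw [continuous_iff_isOpen_apply]
    intro v w
    have : {g : T ≃g T | g⁻¹ v = w} = {g : T ≃g T | g w = v} := by
      ext g
      constructor
      · rintro rfl
        exact g.apply_symm_apply v
      · rintro rfl
        exact g.symm_apply_apply w
    rw [this]
    exact isOpen_apply_eq T w v

/-! ### Burger--Mozes universal groups -/

/-- `E(v)`: the set of edges containing the vertex `v`. -/
abbrev EdgesAt {V : Type*} (T : SimpleGraph V) (v : V) : Type _ :=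
  {e : T.edgeSet // v ∈ (e : Sym2 V)}

/-- `g_v : E(v) → E(g v)`: the bijection induced by the automorphism `g`. -/
def edgesAtEquiv {V : Type*} {T : SimpleGraph V} (g : T ≃g T) (v : V) :
    EdgesAt T v ≃ EdgesAt T (g v) :=
  g.mapEdgeSet.subtypeEquiv fun e => by
    change v ∈ (e : Sym2 V) ↔ g v ∈ Sym2.map g (e : Sym2 V)
    rw [Sym2.mem_map]
    constructor
    · exact fun h => ⟨v, h, rfl⟩
    · rintro ⟨w, hw, h⟩
      rwa [← g.injective h]

/-- A coloring of (the edges of) `T` with `d` colors: an edge labelling whose restriction `c_v` to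
`E(v)` is a bijection onto `{0, …, d - 1}` for each vertex `v`. In particular a graph with such a
coloring is `d`-regular. -/
structure Coloring {V : Type*} (T : SimpleGraph V) (d : ℕ) where
  /-- the color of an edge -/
  color : T.edgeSet → Fin d
  bijective_at : ∀ v : V, Function.Bijective fun e : EdgesAt T v => color e.1

/-- `c_v : E(v) → {0, …, d - 1}` as a bijection. -/
noncomputable def Coloring.colorAt {V : Type*} {T : SimpleGraph V} {d : ℕ} (c : Coloring T d)
    (v : V) : EdgesAt T v ≃ Fin d :=
  Equiv.ofBijective (fun e => c.color e.1) (c.bijective_at v)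

/-- The local action `c_{g v} ∘ g_v ∘ c_v⁻¹` of `g` at `v`. -/
noncomputable def localAction {V : Type*} {T : SimpleGraph V} {d : ℕ} (c : Coloring T d)
    (g : T ≃g T) (v : V) : Equiv.Perm (Fin d) :=
  (c.colorAt v).symm.trans ((edgesAtEquiv g v).trans (c.colorAt (g v)))

theorem localAction_colorAt {V : Type*} {T : SimpleGraph V} {d : ℕ} (c : Coloring T d)
    (g : T ≃g T) (v : V) (e : EdgesAt T v) :
    localAction c g v (c.color e.1) = c.color (g.mapEdgeSet e.1) := by
  have h : (c.colorAt v).symm (c.color e.1) = e := (c.colorAt v).symm_apply_apply e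
  simp only [localAction, Equiv.trans_apply, h]
  rfl

theorem localAction_one {V : Type*} {T : SimpleGraph V} {d : ℕ} (c : Coloring T d) (v : V) :
    localAction c 1 v = 1 := by
  ext1 i
  obtain ⟨e, rfl⟩ := (c.bijective_at v).2 i
  have h : (1 : T ≃g T).mapEdgeSet e.1 = e.1 := Subtype.ext (congrFun Sym2.map_id e.1.1)
  simp only [localAction_colorAt, h, Equiv.Perm.one_apply]

theorem localAction_mul {V : Type*} {T : SimpleGraph V} {d : ℕ} (c : Coloring T d)
    (g h : T ≃g T) (v : V) :
    localAction c (g * h) v = localAction c g (h v) * localAction c h v := by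
  ext1 i
  obtain ⟨e, rfl⟩ := (c.bijective_at v).2 i
  have h1 : (g * h).mapEdgeSet e.1 = g.mapEdgeSet (h.mapEdgeSet e.1) :=
    Subtype.ext (Sym2.map_map (g := g) (f := h) e.1.1).symm
  have h2 := localAction_colorAt c g (h v) (edgesAtEquiv h v e)
  have h3 : (edgesAtEquiv h v e).1 = h.mapEdgeSet e.1 := rfl
  rw [h3] at h2
  simp only [localAction_colorAt, h1, Equiv.Perm.mul_apply, h2]

/-- The Burger--Mozes universal group `U(F)`: the automorphisms of `T` all of whose local actions
lie in `F`. -/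
def universalGroup {V : Type*} {T : SimpleGraph V} {d : ℕ} (c : Coloring T d)
    (F : Subgroup (Equiv.Perm (Fin d))) : Subgroup (T ≃g T) where
  carrier := {g | ∀ v : V, localAction c g v ∈ F}
  one_mem' v := by rw [localAction_one]; exact F.one_mem
  mul_mem' {g h} hg hh v := by
    rw [localAction_mul]
    exact F.mul_mem (hg _) (hh _)
  inv_mem' {g} hg v := by
    have h := localAction_mul c g g⁻¹ v
    rw [mul_inv_cancel, localAction_one] at h
    rw [← inv_eq_of_mul_eq_one_right h.symm]
    exact F.inv_mem (hg _)

/-- `U(F)⁺`: the subgroup generated by the pointwise stabilizers in `U(F)` of the edges of `T`,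
with the subspace topology of the automorphism group. -/
def universalGroupPlus {V : Type*} {T : SimpleGraph V} {d : ℕ} (c : Coloring T d)
    (F : Subgroup (Equiv.Perm (Fin d))) : Subgroup (T ≃g T) :=
  Subgroup.closure {g | g ∈ universalGroup c F ∧ ∃ x y : V, T.Adj x y ∧ g x = x ∧ g y = y}

end BurgerMozes

/-! The rigid stabilizer of a half-tree (one side of an edge) consists of the elements of U(F)
supported there. It is compact, lies in U(F)⁺, and elements of rigid stabilizers of disjoint
half-trees can be glued together, even infinitely many at once. An element fixing an edge is a
product of two such elements, so everything reduces to small elements of the rigid stabilizer R of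
one half-tree.

Uniform width (`exists_comms_pow_rist_half`): there is one M such that, for every half-tree, each
element of R is a product of M commutators from R. Perfectness of the point stabilizers handles the
local action at the root, 2-transitivity gathers the rest into one child, and compactness allows
passing to the limit.

Displacement (`exists_ball_subset_pow`): if countably many pieces cover R, Baire category makes one
of them somewhere dense, so quotients y⁻¹z of its elements approximate every sufficiently small s in
R. Choose s so that it displaces all half-trees of one edge color at a given level. A commutator
supported on this color class is then a product of four conjugates of (y⁻¹z)^{±1}. There are only d
color classes, so some neighborhood of 1 in R consists of products of 4Md such conjugates, an
exponent that does not depend on the cover.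

It remains to control the conjugating elements. Conjugation invariant neighborhoods absorb them. In
general, the diagonal argument `exists_full` finds a half-tree on which every element of its rigid
stabilizer agrees with a quotient of two elements of one piece, and only this restriction matters
for the conjugation. If the pieces are cosets of K, the quotient lies in K; if they are preimages of
translates of a compact neighborhood U, its image lies in the compact set U⁻¹U. This settles one
half-tree. For a homomorphism, conjugation carries continuity to all the others. For K, which need
not be normal, the work of conjugation is done by elements of K that approximate rotations. -/

namespace BurgerMozes

variable {V : Type*} {T : SimpleGraph V} {d : ℕ}

/-! ### Moving along colored edges -/

theorem Coloring.exists_step (c : Coloring T d) (v : V) (i : Fin d) :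
    ∃ w, ∃ h : T.Adj v w, c.color ⟨s(v, w), h⟩ = i := by
  obtain ⟨⟨⟨e, he⟩, hv⟩, hi⟩ := (c.bijective_at v).2 i
  obtain ⟨w, rfl⟩ := Sym2.mem_iff_exists.1 hv
  exact ⟨w, he, hi⟩

/-- The neighbor of `v` along the edge of color `i`. -/
noncomputable def Coloring.step (c : Coloring T d) (v : V) (i : Fin d) : V :=
  (c.exists_step v i).choose

theorem Coloring.adj_step (c : Coloring T d) (v : V) (i : Fin d) : T.Adj v (c.step v i) :=
  (c.exists_step v i).choose_spec.choose

theorem Coloring.color_step (c : Coloring T d) (v : V) (i : Fin d) :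
    c.color ⟨s(v, c.step v i), c.adj_step v i⟩ = i :=
  (c.exists_step v i).choose_spec.choose_spec

theorem Coloring.step_color (c : Coloring T d) {v w : V} (h : T.Adj v w) :
    c.step v (c.color ⟨s(v, w), h⟩) = w := by
  have h1 := (c.bijective_at v).1
    (a₁ := ⟨⟨s(v, c.step v (c.color ⟨s(v, w), h⟩)), c.adj_step _ _⟩, Sym2.mem_mk_left _ _⟩)
    (a₂ := ⟨⟨s(v, w), h⟩, Sym2.mem_mk_left _ _⟩) (c.color_step _ _)
  have h2 : s(v, c.step v (c.color ⟨s(v, w), h⟩)) = s(v, w) :=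
    congrArg (fun e : EdgesAt T v => (e.1 : Sym2 V)) h1
  exact Sym2.congr_right.1 h2

theorem Coloring.exists_eq_step (c : Coloring T d) {v w : V} (h : T.Adj v w) :
    ∃ i, w = c.step v i := ⟨_, (c.step_color h).symm⟩

theorem Coloring.step_injective (c : Coloring T d) (v : V) : Function.Injective (c.step v) := by
  intro i j h
  rw [← c.color_step v i, ← c.color_step v j]
  congr 3

theorem Coloring.step_step (c : Coloring T d) (v : V) (i : Fin d) :
    c.step (c.step v i) i = v := by
  have h := c.step_color (c.adj_step v i).symm
  have h2 : c.color ⟨s(c.step v i, v), (c.adj_step v i).symm⟩ = i := by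
    conv_rhs => rw [← c.color_step v i]
    congr 2
    exact Sym2.eq_swap
  rwa [h2] at h

theorem apply_step (c : Coloring T d) (g : T ≃g T) (v : V) (i : Fin d) :
    g (c.step v i) = c.step (g v) (localAction c g v i) := by
  have h := localAction_colorAt c g v ⟨⟨s(v, c.step v i), c.adj_step v i⟩, Sym2.mem_mk_left _ _⟩
  have h3 : T.Adj (g v) (g (c.step v i)) := g.map_rel_iff.2 (c.adj_step v i)
  have h2 := c.step_color h3
  simp only [c.color_step] at h
  rw [h]
  exact h2.symm

theorem localAction_eq_iff (c : Coloring T d) (g : T ≃g T) (v : V) (σ : Equiv.Perm (Fin d)) :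
    localAction c g v = σ ↔ ∀ i, g (c.step v i) = c.step (g v) (σ i) := by
  refine ⟨fun h i => h ▸ apply_step c g v i, fun h => ?_⟩
  ext1 i
  exact c.step_injective _ ((apply_step c g v i).symm.trans (h i))

theorem localAction_congr (c : Coloring T d) {g f : T ≃g T} {v : V} (h : g v = f v)
    (h' : ∀ i, g (c.step v i) = f (c.step v i)) : localAction c g v = localAction c f v := by
  rw [localAction_eq_iff]
  intro i
  rw [h', h, apply_step]

/-- An automorphism from a permutation of the vertices with prescribed local actions. -/
theorem exists_aut_of_equiv (c : Coloring T d) (e : V ≃ V) (σ : V → Equiv.Perm (Fin d))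
    (h : ∀ v i, e (c.step v i) = c.step (e v) (σ v i)) :
    ∃ g : T ≃g T, (∀ v, g v = e v) ∧ ∀ v, localAction c g v = σ v := by
  let g : T ≃g T :=
    { toEquiv := e
      map_rel_iff' := by
        intro v w
        constructor
        · intro hvw
          obtain ⟨k, hk⟩ := c.exists_eq_step hvw
          obtain ⟨i, rfl⟩ := (σ v).surjective k
          rw [← h] at hk
          rw [e.injective hk]
          exact c.adj_step _ _
        · intro hvw
          obtain ⟨i, rfl⟩ := c.exists_eq_step hvw
          rw [h]
          exact c.adj_step _ _ }
  exact ⟨g, fun _ => rfl, fun v => (localAction_eq_iff c g v (σ v)).2 (h v)⟩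

theorem induction_on_step (hT : T.IsTree) (c : Coloring T d) (x : V) {P : V → Prop} (h0 : P x)
    (h : ∀ v i, P v → P (c.step v i)) (v : V) : P v := by
  obtain ⟨p⟩ := hT.connected.preconnected v x
  induction p with
  | nil => exact h0
  | cons hadj p ih =>
    obtain ⟨i, hi⟩ := c.exists_eq_step hadj.symm
    rw [hi]
    exact h _ _ (ih h0)

/-! ### Distances -/

theorem dist_apply (g : T ≃g T) (v w : V) : T.dist (g v) (g w) = T.dist v w := by
  simp only [SimpleGraph.dist]
  congr 1
  simp only [SimpleGraph.edist]
  apply le_antisymm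
  · refine le_iInf fun p => (iInf_le _ (p.map g.toHom)).trans ?_
    simp
  · refine le_iInf fun p => (iInf_le _ ((p.map g.symm.toHom).copy (g.symm_apply_apply v)
      (g.symm_apply_apply w))).trans ?_
    simp

theorem dist_step (hT : T.IsTree) (c : Coloring T d) (u v : V) (i : Fin d) :
    T.dist u (c.step v i) = T.dist u v + 1 ∨ T.dist u v = T.dist u (c.step v i) + 1 :=
  (hT.dist_eq_dist_add_one_of_adj u (c.adj_step v i)).symm

theorem exists_step_closer (hT : T.IsTree) (c : Coloring T d) {u v : V} (h : v ≠ u) :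
    ∃ i, T.dist u v = T.dist u (c.step v i) + 1 := by
  obtain ⟨p, hp⟩ := hT.connected.exists_walk_length_eq_dist v u
  cases p with
  | nil => exact absurd rfl h
  | cons hadj p =>
    obtain ⟨i, rfl⟩ := c.exists_eq_step hadj
    refine ⟨i, ?_⟩
    have h1 := SimpleGraph.dist_le p
    rw [SimpleGraph.Walk.length_cons] at hp
    rw [T.dist_comm] at h1
    rw [T.dist_comm (u := v)] at hp
    have := dist_step hT c u v i
    omega

/-- Each closer neighbor begins a geodesic from `v` to `u`, and paths in a tree are unique. -/
theorem step_closer_unique (hT : T.IsTree) (c : Coloring T d) {u v : V} {i j : Fin d}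
    (hi : T.dist u (c.step v i) < T.dist u v) (hj : T.dist u (c.step v j) < T.dist u v) :
    i = j := by
  have key : ∀ k, T.dist u (c.step v k) < T.dist u v → ∃ p : T.Walk v u, p.IsPath ∧
      p.snd = c.step v k := by
    intro k hk
    obtain ⟨p, hp, hl⟩ := hT.connected.exists_path_of_dist (c.step v k) u
    refine ⟨.cons (c.adj_step v k) p, ?_, by simp⟩
    apply SimpleGraph.Walk.isPath_of_length_eq_dist
    rw [SimpleGraph.Walk.length_cons, hl, T.dist_comm, T.dist_comm (u := v)]
    have := dist_step hT c u v k
    omega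
  obtain ⟨p, hp, hpi⟩ := key i hi
  obtain ⟨q, hq, hqj⟩ := key j hj
  have := (hT.existsUnique_path v u).unique hp hq
  subst this
  exact c.step_injective v (hpi.symm.trans hqj)

/-! ### Half-trees -/

/-- The half-tree rooted at `x` which does not contain the neighbor of `x` along the edge of
color `i`. -/
def half (c : Coloring T d) (x : V) (i : Fin d) : Set V :=
  {v | T.dist v x < T.dist v (c.step x i)}

theorem mem_half {c : Coloring T d} {x v : V} {i : Fin d} :
    v ∈ half c x i ↔ T.dist v x < T.dist v (c.step x i) := Iff.rfl

theorem root_mem_half (hT : T.IsTree) (c : Coloring T d) (x : V) (i : Fin d) : x ∈ half c x i := by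
  rw [mem_half]
  have := dist_step hT c x x i
  rw [T.dist_self] at *
  omega

theorem not_mem_half_iff (hT : T.IsTree) (c : Coloring T d) {x v : V} {i : Fin d} :
    v ∉ half c x i ↔ v ∈ half c (c.step x i) i := by
  rw [mem_half, mem_half, c.step_step]
  have := dist_step hT c v x i
  omega

theorem step_not_mem_half (hT : T.IsTree) (c : Coloring T d) (x : V) (i : Fin d) :
    c.step x i ∉ half c x i :=
  (not_mem_half_iff hT c).2 (root_mem_half hT c _ _)

/-- The only edge leaving a half-tree is the one at its root. -/
theorem half_boundary (hT : T.IsTree) (c : Coloring T d) {x v w : V} {i : Fin d} (h : T.Adj v w)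
    (hv : v ∈ half c x i) (hw : w ∉ half c x i) : v = x ∧ w = c.step x i := by
  have hw' := (not_mem_half_iff hT c).1 hw
  rw [mem_half, c.step_step] at hw'
  rw [mem_half] at hv
  obtain ⟨j, rfl⟩ := c.exists_eq_step h
  have e1 := dist_step hT c v x i
  have e2 := dist_step hT c (c.step v j) x i
  have e3 := dist_step hT c x v j
  have e4 := dist_step hT c (c.step x i) v j
  simp only [T.dist_comm (u := x), T.dist_comm (u := c.step x i)] at e3 e4
  -- The distances force `w` to be nearer than `v` to the far end of the root edge and farther from
  -- `x`. If `v ≠ x`, the neighbor of `v` towards `x` is also nearer to that far end, hence equals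
  -- `w`, a contradiction.
  have hvx : v = x := by
    by_contra hne
    obtain ⟨k, hk⟩ := exists_step_closer hT c hne
    have e5 := dist_step hT c (c.step x i) v k
    have e6 := dist_step hT c (c.step v k) x i
    simp only [T.dist_comm (u := x), T.dist_comm (u := c.step x i)] at hk e5
    have hjk : j = k := by
      apply step_closer_unique hT c (u := c.step x i) (v := v)
      · simp only [T.dist_comm (u := c.step x i)]; omega
      · simp only [T.dist_comm (u := c.step x i)]; omega
    subst hjk
    omega
  subst hvx
  refine ⟨rfl, ?_⟩
  rw [T.dist_self] at *
  have : T.dist (c.step v j) (c.step v i) = 0 := by omega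
  exact hT.connected.dist_eq_zero_iff.1 this

theorem half_child_subset (hT : T.IsTree) (c : Coloring T d) {x : V} {i j : Fin d} (h : j ≠ i) :
    half c (c.step x j) j ⊆ half c x i := by
  intro v hv
  rw [mem_half, c.step_step] at hv
  rw [mem_half]
  by_contra hlt
  have := dist_step hT c v x i
  exact h (step_closer_unique hT c hv (by omega))

theorem half_child_disjoint (hT : T.IsTree) (c : Coloring T d) {x v : V} {j k : Fin d}
    (hj : v ∈ half c (c.step x j) j) (hk : v ∈ half c (c.step x k) k) : j = k := by
  rw [mem_half, c.step_step] at hj hk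
  exact step_closer_unique hT c hj hk

theorem exists_half_child (hT : T.IsTree) (c : Coloring T d) {x v : V} {i : Fin d}
    (hv : v ∈ half c x i) (hx : v ≠ x) : ∃ j, j ≠ i ∧ v ∈ half c (c.step x j) j := by
  obtain ⟨j, hj⟩ := exists_step_closer hT c (Ne.symm hx)
  refine ⟨j, ?_, ?_⟩
  · rintro rfl
    rw [mem_half] at hv
    omega
  · rw [mem_half, c.step_step]
    omega

theorem apply_mem_half (c : Coloring T d) (g : T ≃g T) {x v : V} {i : Fin d} :
    g v ∈ half c (g x) (localAction c g x i) ↔ v ∈ half c x i := by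
  rw [mem_half, ← apply_step, dist_apply, dist_apply, mem_half]

/-! ### Levels of a half-tree -/

/-- The half-trees `n` levels below the half-tree `half c x i`, as pairs of a root and the color of
the edge from the root to its parent. -/
def level (c : Coloring T d) (x : V) (i : Fin d) : ℕ → Set (V × Fin d)
  | 0 => {(x, i)}
  | n + 1 => {q | ∃ p ∈ level c x i n, ∃ j, j ≠ p.2 ∧ q = (c.step p.1 j, j)}

theorem level_half_subset (hT : T.IsTree) (c : Coloring T d) {x : V} {i : Fin d} :
    ∀ {n : ℕ} {p : V × Fin d}, p ∈ level c x i n → half c p.1 p.2 ⊆ half c x i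
  | 0, p, h => by
    rw [level, Set.mem_singleton_iff] at h
    rw [h]
  | n + 1, p, h => by
    obtain ⟨q, hq, j, hj, rfl⟩ := h
    exact (half_child_subset hT c hj).trans (level_half_subset hT c hq)

theorem level_disjoint (hT : T.IsTree) (c : Coloring T d) {x v : V} {i : Fin d} :
    ∀ {n : ℕ} {p q : V × Fin d}, p ∈ level c x i n → q ∈ level c x i n →
      v ∈ half c p.1 p.2 → v ∈ half c q.1 q.2 → p = q
  | 0, p, q, hp, hq, _, _ => hp.trans hq.symm
  | n + 1, p, q, hp, hq, hvp, hvq => by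
    obtain ⟨p', hp', j, hj, rfl⟩ := hp
    obtain ⟨q', hq', k, hk, rfl⟩ := hq
    obtain rfl := level_disjoint hT c hp' hq' (half_child_subset hT c hj hvp)
      (half_child_subset hT c hk hvq)
    obtain rfl := half_child_disjoint hT c hvp hvq
    rfl

theorem dist_of_mem_level (hT : T.IsTree) (c : Coloring T d) {x v : V} {i : Fin d} :
    ∀ {n : ℕ} {p : V × Fin d}, p ∈ level c x i n → v ∈ half c p.1 p.2 →
      T.dist v x = T.dist v p.1 + n
  | 0, p, h, _ => by
    rw [level, Set.mem_singleton_iff] at h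
    rw [h, add_zero]
  | n + 1, p, h, hv => by
    obtain ⟨q, hq, j, hj, rfl⟩ := h
    have h1 := dist_of_mem_level hT c hq (half_child_subset hT c hj hv)
    rw [mem_half, c.step_step] at hv
    have := dist_step hT c v q.1 j
    dsimp only at hv ⊢
    omega

theorem level_dist (hT : T.IsTree) (c : Coloring T d) {x : V} {i : Fin d} {n : ℕ}
    {p : V × Fin d} (hp : p ∈ level c x i n) : T.dist p.1 x = n := by
  rw [dist_of_mem_level hT c hp (root_mem_half hT c _ _), T.dist_self, zero_add]

theorem exists_level (hT : T.IsTree) (c : Coloring T d) {x v : V} {i : Fin d}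
    (hv : v ∈ half c x i) (n : ℕ) : n ≤ T.dist v x → ∃ p ∈ level c x i n, v ∈ half c p.1 p.2 := by
  induction n with
  | zero => exact fun _ => ⟨(x, i), rfl, hv⟩
  | succ n ih =>
    intro hn
    obtain ⟨p, hp, hvp⟩ := ih (by omega)
    have hne : v ≠ p.1 := by
      rintro rfl
      rw [level_dist hT c hp] at hn
      omega
    obtain ⟨j, hj, hvj⟩ := exists_half_child hT c hvp hne
    exact ⟨_, ⟨p, hp, j, hj, rfl⟩, hvj⟩

/-! ### Automorphisms with constant local action -/

theorem exists_equivariant_map (hT : T.IsTree) (c : Coloring T d) (x y : V)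
    (a : Equiv.Perm (Fin d)) :
    ∃ f : V → V, f x = y ∧ ∀ v i, f (c.step v i) = c.step (f v) (a i) := by
  have hs : ∀ v, v ≠ x → ∃ i, T.dist x v = T.dist x (c.step v i) + 1 := fun v hv =>
    exists_step_closer hT c hv
  -- The first argument is recursion fuel, later set to the distance of `v` from `x`; the value is
  -- computed from the neighbor of `v` closer to `x`. The value `y` at `x` is the seed.
  let F : ℕ → V → V := fun n => Nat.rec (fun _ => y) (fun _ f v =>
    open Classical in if h : v ≠ x then c.step (f (c.step v (hs v h).choose)) (a (hs v h).choose)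
      else y) n
  have key : ∀ v i, T.dist x (c.step v i) = T.dist x v + 1 →
      F (T.dist x (c.step v i)) (c.step v i) = c.step (F (T.dist x v) v) (a i) := by
    intro v i h
    have hne : c.step v i ≠ x := by
      intro he
      rw [he, T.dist_self] at h
      omega
    have hi : (hs _ hne).choose = i := by
      have h1 := (hs _ hne).choose_spec
      refine step_closer_unique hT c (u := x) (v := c.step v i) (by omega) ?_
      rw [c.step_step]
      omega
    have e : F (T.dist x v + 1) (c.step v i) =
        c.step (F (T.dist x v) (c.step (c.step v i) (hs _ hne).choose)) (a (hs _ hne).choose) :=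
      dif_pos hne
    rw [h, e, hi, c.step_step]
  refine ⟨fun v => F (T.dist x v) v, ?_, fun v i => ?_⟩
  · show F (T.dist x x) x = y
    rw [T.dist_self]
    rfl
  · rcases dist_step hT c x v i with h | h
    · exact key v i h
    · have h2 := key (c.step v i) i (by rw [c.step_step]; exact h)
      rw [c.step_step] at h2
      show F _ _ = c.step (F _ _) _
      rw [h2, c.step_step]

/-- The equivariant maps for (x, y, a) and (y, x, a⁻¹) are mutually inverse: their composites fix a
vertex and preserve all colored steps. -/
theorem exists_aut_const (hT : T.IsTree) (c : Coloring T d) (x y : V)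
    (a : Equiv.Perm (Fin d)) : ∃ g : T ≃g T, g x = y ∧ ∀ v, localAction c g v = a := by
  have key : ∀ (x y : V) (a : Equiv.Perm (Fin d)) (f k : V → V), f x = y → k y = x →
      (∀ v i, f (c.step v i) = c.step (f v) (a i)) →
      (∀ v i, k (c.step v i) = c.step (k v) (a⁻¹ i)) → ∀ v, k (f v) = v := by
    intro x y a f k hf hk hf' hk' v
    refine induction_on_step hT c x (P := fun v => k (f v) = v) (by rw [hf, hk]) ?_ v
    intro v i hv
    rw [hf', hk', hv]
    simp
  obtain ⟨f, hf, hf'⟩ := exists_equivariant_map hT c x y a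
  obtain ⟨k, hk, hk'⟩ := exists_equivariant_map hT c y x a⁻¹
  obtain ⟨g, hg, hg'⟩ := exists_aut_of_equiv c
    ⟨f, k, key x y a f k hf hk hf' hk',
      key y x a⁻¹ k f hk hf hk' (by simpa using hf')⟩ (fun _ => a) hf'
  exact ⟨g, (hg x).trans hf, hg'⟩

/-! ### Rigid stabilizers -/

/-- The rigid stabilizer in `U(F)` of a set `Y` of vertices: the elements of `U(F)` fixing all
vertices outside of `Y`. -/
def rist (c : Coloring T d) (F : Subgroup (Equiv.Perm (Fin d))) (Y : Set V) :
    Subgroup (T ≃g T) where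
  carrier := {g | g ∈ universalGroup c F ∧ ∀ v, v ∉ Y → g v = v}
  one_mem' := ⟨one_mem _, fun _ _ => rfl⟩
  mul_mem' {g h} hg hh := ⟨mul_mem hg.1 hh.1, fun v hv => by
    show g (h v) = v
    rw [hh.2 v hv, hg.2 v hv]⟩
  inv_mem' {g} hg := ⟨inv_mem hg.1, fun v hv => by
    show g.symm v = v
    rw [RelIso.symm_apply_eq, hg.2 v hv]⟩

section rist

variable {c : Coloring T d} {F : Subgroup (Equiv.Perm (Fin d))} {Y Z : Set V} {g h : T ≃g T}

theorem mul_apply' (v : V) : (g * h) v = g (h v) := rfl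

theorem inv_apply_eq_iff {v w : V} : g⁻¹ v = w ↔ v = g w := RelIso.symm_apply_eq g

theorem apply_inv_apply (v : V) : g (g⁻¹ v) = v := g.apply_symm_apply v

theorem inv_apply_apply (v : V) : g⁻¹ (g v) = v := g.symm_apply_apply v

theorem rist_mono (h : Y ⊆ Z) : rist c F Y ≤ rist c F Z :=
  fun _ hg => ⟨hg.1, fun v hv => hg.2 v fun hY => hv (h hY)⟩

theorem apply_mem_iff_of_mem_rist (hg : g ∈ rist c F Y) {v : V} : g v ∈ Y ↔ v ∈ Y := by
  constructor
  · intro h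
    by_contra hv
    rw [hg.2 v hv] at h
    exact hv h
  · intro h
    by_contra hv
    have := g.injective (hg.2 _ hv)
    rw [this] at hv
    exact hv h

theorem commute_of_disjoint (hg : g ∈ rist c F Y) (hh : h ∈ rist c F Z) (hYZ : Disjoint Y Z) :
    g * h = h * g := by
  ext v
  rw [mul_apply', mul_apply']
  by_cases hv : v ∈ Y
  · have h1 : v ∉ Z := fun hZ => Set.disjoint_left.1 hYZ hv hZ
    have h2 : g v ∉ Z := fun hZ =>
      Set.disjoint_left.1 hYZ ((apply_mem_iff_of_mem_rist hg).2 hv) hZ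
    rw [hh.2 _ h1, hh.2 _ h2]
  · rw [hg.2 _ hv]
    by_cases hZ : v ∈ Z
    · have : h v ∉ Y := fun hY =>
        Set.disjoint_left.1 hYZ hY ((apply_mem_iff_of_mem_rist hh).2 hZ)
      rw [hg.2 _ this]
    · rw [hh.2 _ hZ, hg.2 _ hv]

theorem conj_mem_rist (hg : g ∈ universalGroup c F) (hh : h ∈ rist c F Y)
    (hYZ : ∀ v, v ∈ Y → g v ∈ Z) : g * h * g⁻¹ ∈ rist c F Z := by
  refine ⟨mul_mem (mul_mem hg hh.1) (inv_mem hg), fun v hv => ?_⟩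
  rw [mul_apply', mul_apply', hh.2, apply_inv_apply]
  intro hY
  apply hv
  have := hYZ _ hY
  rwa [apply_inv_apply] at this

theorem fix_parent (hT : T.IsTree) {x : V} {i : Fin d} (hg : g ∈ rist c F (half c x i)) :
    g (c.step x i) = c.step x i := hg.2 _ (step_not_mem_half hT c x i)

theorem fix_root (hT : T.IsTree) {x : V} {i : Fin d} (hg : g ∈ rist c F (half c x i)) :
    g x = x := by
  have h1 : T.Adj (g x) (c.step x i) := by
    have := g.map_rel_iff.2 (c.adj_step x i)
    rwa [fix_parent hT hg] at this
  exact (half_boundary hT c h1 ((apply_mem_iff_of_mem_rist hg).2 (root_mem_half hT c x i))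
    (step_not_mem_half hT c x i)).1

theorem localAction_root (hT : T.IsTree) {x : V} {i : Fin d} (hg : g ∈ rist c F (half c x i)) :
    localAction c g x i = i := by
  have := apply_step c g x i
  rw [fix_parent hT hg, fix_root hT hg] at this
  exact (c.step_injective x this).symm

theorem mem_universalGroupPlus_of_rist_half (hT : T.IsTree) {x : V} {i : Fin d}
    (hg : g ∈ rist c F (half c x i)) : g ∈ universalGroupPlus c F :=
  Subgroup.subset_closure ⟨hg.1, x, c.step x i, c.adj_step x i, fix_root hT hg, fix_parent hT hg⟩

end rist

/-! ### Gluing -/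

/-- Elements of `U(F)` can be glued along a partition of the vertices provided they preserve the
pieces and fix the edges between different pieces. -/
theorem exists_glue (c : Coloring T d) (F : Subgroup (Equiv.Perm (Fin d))) {ι : Type*}
    (κ : V → ι) (g : ι → T ≃g T) (hg : ∀ k, g k ∈ universalGroup c F)
    (h1 : ∀ v, κ (g (κ v) v) = κ v) (h2 : ∀ v, κ ((g (κ v))⁻¹ v) = κ v)
    (h3 : ∀ v w, T.Adj v w → κ v ≠ κ w → g (κ v) v = v ∧ g (κ v) w = w) :
    ∃ f ∈ universalGroup c F, ∀ v, f v = g (κ v) v := by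
  let e : V ≃ V :=
    { toFun := fun v => g (κ v) v
      invFun := fun v => (g (κ v))⁻¹ v
      left_inv := fun v => by
        show (g (κ (g (κ v) v)))⁻¹ (g (κ v) v) = v
        rw [h1, inv_apply_apply]
      right_inv := fun v => by
        show g (κ ((g (κ v))⁻¹ v)) ((g (κ v))⁻¹ v) = v
        rw [h2, apply_inv_apply] }
  obtain ⟨f, hf, hf'⟩ := exists_aut_of_equiv c e (fun v => localAction c (g (κ v)) v) (by
    intro v i
    show g (κ (c.step v i)) (c.step v i) = c.step (g (κ v) v) _
    rw [← apply_step]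
    by_cases h : κ v = κ (c.step v i)
    · rw [h]
    · rw [(h3 _ _ (c.adj_step v i).symm (Ne.symm h)).1, (h3 _ _ (c.adj_step v i) h).2])
  exact ⟨f, fun v => hf' v ▸ hg _ v, hf⟩

/-- Gluing elements of the rigid stabilizers of disjoint half-trees. -/
theorem exists_glue_half (hT : T.IsTree) (c : Coloring T d) (F : Subgroup (Equiv.Perm (Fin d)))
    (A : Set (V × Fin d)) (hA : ∀ p ∈ A, ∀ q ∈ A, ∀ v, v ∈ half c p.1 p.2 →
      v ∈ half c q.1 q.2 → p = q) (g : V × Fin d → T ≃g T)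
    (hg : ∀ p ∈ A, g p ∈ rist c F (half c p.1 p.2)) :
    ∃ f ∈ rist c F (⋃ p ∈ A, half c p.1 p.2), ∀ p ∈ A, ∀ v ∈ half c p.1 p.2, f v = g p v := by
  classical
  let κ : V → Option (V × Fin d) := fun v =>
    if h : ∃ p ∈ A, v ∈ half c p.1 p.2 then some h.choose else none
  have κ_some : ∀ v p, κ v = some p ↔ p ∈ A ∧ v ∈ half c p.1 p.2 := by
    intro v p
    simp only [κ]
    split_ifs with h
    · rw [Option.some_inj]
      constructor
      · rintro rfl
        exact h.choose_spec
      · intro hp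
        exact hA _ h.choose_spec.1 _ hp.1 v h.choose_spec.2 hp.2
    · simp only [false_iff]
      exact fun hp => h ⟨p, hp⟩
  have κ_none : ∀ v, κ v = none ↔ ∀ p ∈ A, v ∉ half c p.1 p.2 := by
    intro v
    simp only [κ]
    split_ifs with h
    · simp only [false_iff]
      exact fun hp => hp _ h.choose_spec.1 h.choose_spec.2
    · simp only [true_iff]
      exact fun p hp hv => h ⟨p, hp, hv⟩
  let G : Option (V × Fin d) → T ≃g T := fun k =>
    k.elim 1 fun p => if p ∈ A then g p else 1
  have G_some : ∀ p ∈ A, G (some p) = g p := fun p hp => if_pos hp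
  have glue := exists_glue c F κ G ?_ ?_ ?_ ?_
  · obtain ⟨f, hf, hf'⟩ := glue
    refine ⟨f, ⟨hf, fun v hv => ?_⟩, fun p hp v hv => ?_⟩
    · rw [hf', (κ_none v).2]
      · rfl
      · exact fun p hp h => hv (Set.mem_biUnion hp h)
    · rw [hf', (κ_some v p).2 ⟨hp, hv⟩, G_some p hp]
  · rintro (_ | p)
    · exact one_mem _
    · show (if p ∈ A then g p else 1) ∈ _
      split_ifs with h
      · exact (hg p h).1
      · exact one_mem _
  · intro v
    rcases h : κ v with _ | p
    · exact h
    · have hp := (κ_some v p).1 h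
      rw [G_some p hp.1, κ_some]
      exact ⟨hp.1, (apply_mem_iff_of_mem_rist (hg p hp.1)).2 hp.2⟩
  · intro v
    rcases h : κ v with _ | p
    · exact h
    · have hp := (κ_some v p).1 h
      rw [G_some p hp.1, κ_some]
      exact ⟨hp.1, (apply_mem_iff_of_mem_rist (inv_mem (hg p hp.1))).2 hp.2⟩
  · intro v w hvw hne
    rcases h : κ v with _ | p
    · exact ⟨rfl, rfl⟩
    · have hp := (κ_some v p).1 h
      have hw : w ∉ half c p.1 p.2 := fun hw => hne (h.trans ((κ_some w p).2 ⟨hp.1, hw⟩).symm)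
      obtain ⟨rfl, rfl⟩ := half_boundary hT c hvw hp.2 hw
      rw [G_some p hp.1]
      exact ⟨fix_root hT (hg p hp.1), fix_parent hT (hg p hp.1)⟩

/-- Restriction of an element of `U(F)` to a half-tree whose root edge it fixes. -/
theorem exists_restrict_half (hT : T.IsTree) (c : Coloring T d) (F : Subgroup (Equiv.Perm (Fin d)))
    {x : V} {i : Fin d} {g : T ≃g T} (hg : g ∈ universalGroup c F) (hx : g x = x)
    (hx' : g (c.step x i) = c.step x i) :
    ∃ f ∈ rist c F (half c x i), ∀ v ∈ half c x i, f v = g v := by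
  classical
  have key : ∀ h : T ≃g T, h x = x → h (c.step x i) = c.step x i →
      ∀ v, h v ∈ half c x i ↔ v ∈ half c x i := by
    intro h hx hx' v
    have := dist_apply h v x
    have := dist_apply h v (c.step x i)
    rw [mem_half, mem_half]
    simp_all
  have hx1 : g⁻¹ x = x := inv_apply_eq_iff.2 hx.symm
  have hx1' : g⁻¹ (c.step x i) = c.step x i := inv_apply_eq_iff.2 hx'.symm
  have glue := exists_glue c F (fun v => decide (v ∈ half c x i))
    (fun b => bif b then g else 1) ?_ ?_ ?_ ?_
  · obtain ⟨f, hf, hf'⟩ := glue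
    refine ⟨f, ⟨hf, fun v hv => ?_⟩, fun v hv => ?_⟩
    · rw [hf', decide_eq_false hv]; rfl
    · rw [hf', decide_eq_true hv]; rfl
  · rintro (_ | _)
    · exact one_mem _
    · exact hg
  · intro v
    by_cases h : v ∈ half c x i
    · simp only [h, decide_true, cond_true, (key g hx hx' v).2 h]
    · simp only [h, decide_false, cond_false, RelIso.one_apply]
  · intro v
    by_cases h : v ∈ half c x i
    · simp only [h, decide_true, cond_true, (key _ hx1 hx1' v).2 h]
    · simp only [h, decide_false, cond_false, inv_one, RelIso.one_apply]
  · intro v w hvw hne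
    by_cases h : v ∈ half c x i
    · have hw : w ∉ half c x i := fun hw => hne (by simp only [h, hw])
      obtain ⟨rfl, rfl⟩ := half_boundary hT c hvw h hw
      simp only [h, decide_true, cond_true]
      exact ⟨hx, hx'⟩
    · simp only [h, decide_false, cond_false, RelIso.one_apply, and_self]

/-- Elements of the point stabilizer `F_i` lift to the rigid stabilizer of a half-tree. -/
theorem exists_lift (hT : T.IsTree) (c : Coloring T d) {F : Subgroup (Equiv.Perm (Fin d))}
    (x : V) {i : Fin d} {a : Equiv.Perm (Fin d)} (ha : a ∈ F) (hai : a i = i) :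
    ∃ f ∈ rist c F (half c x i), localAction c f x = a := by
  obtain ⟨g, hgx, hg⟩ := exists_aut_const hT c x x a
  have hg' : g (c.step x i) = c.step x i := by rw [apply_step, hgx, hg, hai]
  obtain ⟨f, hf, hf'⟩ := exists_restrict_half hT c F (fun v => (hg v).symm ▸ ha) hgx hg'
  refine ⟨f, hf, ?_⟩
  rw [← hg x]
  apply localAction_congr c (hf' x (root_mem_half hT c x i))
  intro j
  by_cases hj : j = i
  · rw [hj, fix_parent hT hf, hg']
  · exact hf' _ (half_child_subset hT c hj (root_mem_half hT c _ j))

/-! ### Topology -/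

theorem finite_ball (hT : T.IsTree) (c : Coloring T d) (x : V) (n : ℕ) :
    {v | T.dist v x ≤ n}.Finite := by
  induction n with
  | zero =>
    refine (Set.finite_singleton x).subset fun v hv => ?_
    exact hT.connected.dist_eq_zero_iff.1 (Nat.le_zero.1 hv)
  | succ n ih =>
    refine (ih.union (Set.finite_iUnion fun i : Fin d => ih.image fun v => c.step v i)).subset ?_
    intro v hv
    by_cases h : v = x
    · left
      rw [h, Set.mem_ofPred_eq, T.dist_self]
      exact Nat.zero_le n
    · right
      obtain ⟨i, hi⟩ := exists_step_closer hT c h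
      rw [T.dist_comm, T.dist_comm (v := c.step v i)] at hi
      rw [Set.mem_ofPred_eq] at hv
      refine Set.mem_iUnion.2 ⟨i, c.step v i, ?_, c.step_step v i⟩
      rw [Set.mem_ofPred_eq]
      omega

theorem exists_finite_of_mem_nhds {g : T ≃g T} {U : Set (T ≃g T)} (hU : U ∈ 𝓝 g) :
    ∃ S : Set V, S.Finite ∧ ∀ h : T ≃g T, (∀ v ∈ S, h v = g v) → h ∈ U := by
  let _ : TopologicalSpace V := ⊥
  have _ : DiscreteTopology V := ⟨rfl⟩
  rw [nhds_induced, Filter.mem_comap] at hU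
  obtain ⟨W, hW, hWU⟩ := hU
  rw [nhds_pi, Filter.mem_pi] at hW
  obtain ⟨I, hI, t, ht, hIt⟩ := hW
  refine ⟨I, hI, fun h hh => hWU (hIt fun v hv => ?_)⟩
  have h1 := hh v hv
  dsimp only at h1 ⊢
  rw [h1]
  exact mem_of_mem_nhds (ht v)

theorem mem_nhds_of_finite {g : T ≃g T} {U : Set (T ≃g T)} {S : Set V} (hS : S.Finite)
    (h : ∀ h : T ≃g T, (∀ v ∈ S, h v = g v) → h ∈ U) : U ∈ 𝓝 g := by
  have h1 : (⋂ v ∈ S, {h : T ≃g T | h v = g v}) ∈ 𝓝 g :=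
    (Filter.biInter_mem hS).2 fun v _ => (isOpen_apply_eq T v (g v)).mem_nhds rfl
  exact Filter.mem_of_superset h1 fun f hf => h f (by simpa using hf)

/-- Balls around a fixed vertex define neighborhood bases. -/
theorem mem_nhds_iff_ball (hT : T.IsTree) (c : Coloring T d) (x : V) {g : T ≃g T}
    {U : Set (T ≃g T)} :
    U ∈ 𝓝 g ↔ ∃ n, ∀ h : T ≃g T, (∀ v, T.dist v x ≤ n → h v = g v) → h ∈ U := by
  constructor
  · intro hU
    obtain ⟨S, hS, h⟩ := exists_finite_of_mem_nhds hU
    obtain ⟨n, hn⟩ := (hS.image fun v => T.dist v x).bddAbove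
    exact ⟨n, fun f hf => h f fun v hv => hf v (hn (Set.mem_image_of_mem _ hv))⟩
  · rintro ⟨n, hn⟩
    exact mem_nhds_of_finite (finite_ball hT c x n) hn

instance autT2Space : T2Space (T ≃g T) where
  t2 g h hne := by
    obtain ⟨v, hv⟩ : ∃ v, g v ≠ h v := by
      by_contra! hall
      exact hne (RelIso.ext hall)
    refine ⟨{f | f v = g v}, {f | f v = h v}, isOpen_apply_eq T _ _, isOpen_apply_eq T _ _, rfl,
      rfl, ?_⟩
    rw [Set.disjoint_left]
    intro f h1 h2
    exact hv (h1.symm.trans h2)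

/-- All elements fix `x`, so orbits lie in finite spheres and an ultrafilter has pointwise limits.
Taking the limits of both g and g⁻¹ makes the limit map bijective. -/
theorem isCompact_rist (hT : T.IsTree) (c : Coloring T d) (F : Subgroup (Equiv.Perm (Fin d)))
    {Y : Set V} {x : V} (hx : x ∉ Y) : IsCompact (rist c F Y : Set (T ≃g T)) := by
  rw [isCompact_iff_ultrafilter_le_nhds]
  intro 𝒰 h𝒰
  have hR : ∀ᶠ g in 𝒰, g ∈ rist c F Y := Filter.le_principal_iff.1 h𝒰
  have hlim : ∀ k : (T ≃g T) → (T ≃g T), (∀ g ∈ rist c F Y, k g ∈ rist c F Y) →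
      ∀ v, ∃ w, ∀ᶠ g in 𝒰, k g v = w := by
    intro k hk v
    have h1 : (⋃ w ∈ {w | T.dist w x ≤ T.dist v x}, {g | k g v = w}) ∈ 𝒰 := by
      filter_upwards [hR] with g hg
      simp only [Set.mem_iUnion]
      refine ⟨k g v, ?_, rfl⟩
      have := dist_apply (k g) v x
      rw [(hk g hg).2 x hx] at this
      exact this.le
    obtain ⟨w, _, hw⟩ := (Ultrafilter.finite_biUnion_mem_iff (finite_ball hT c x _)).1 h1
    exact ⟨w, hw⟩
  choose f hf using hlim (fun g => g) fun _ h => h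
  choose k hk using hlim (fun g => g⁻¹) fun _ h => inv_mem h
  let e : V ≃ V :=
    { toFun := f
      invFun := k
      left_inv := fun v => by
        obtain ⟨g, h1, h2⟩ := ((hf v).and (hk (f v))).exists
        rw [← h2, ← h1, inv_apply_apply]
      right_inv := fun v => by
        obtain ⟨g, h1, h2⟩ := ((hk v).and (hf (k v))).exists
        rw [← h2, ← h1, apply_inv_apply] }
  -- A single group element realizes the limit at `v` and its finitely many neighbors; its local
  -- action there lies in `F`.
  have hσ : ∀ v, ∃ σ ∈ F, ∀ i, f (c.step v i) = c.step (f v) (σ i) := by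
    intro v
    obtain ⟨g, hg, h1, h2⟩ := (hR.and ((hf v).and
      (Filter.eventually_all.2 fun i => hf (c.step v i)))).exists
    exact ⟨_, hg.1 v, fun i => by rw [← h2 i, ← h1, apply_step]⟩
  choose σ hσF hσ using hσ
  obtain ⟨g, hg, hg'⟩ := exists_aut_of_equiv c e σ hσ
  refine ⟨g, ⟨fun v => hg' v ▸ hσF v, fun v hv => ?_⟩, ?_⟩
  · rw [hg]
    obtain ⟨g, hg, h1⟩ := (hR.and (hf v)).exists
    exact h1.symm.trans (hg.2 v hv)
  · intro U hU
    obtain ⟨S, hS, h⟩ := exists_finite_of_mem_nhds hU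
    have : ∀ᶠ g' : T ≃g T in 𝒰, ∀ v ∈ S, g' v = g v :=
      (Filter.eventually_all_finite hS).2 fun v _ => (hf v).mono fun g' hg' => hg'.trans (hg v).symm
    exact Filter.mem_of_superset this fun g' hg' => h g' hg'

/-- In a countable cover of a compact rigid stabilizer, one of the pieces is somewhere dense. -/
theorem exists_dense_piece (hT : T.IsTree) (c : Coloring T d) (F : Subgroup (Equiv.Perm (Fin d)))
    {Y : Set V} {x₀ : V} (hx₀ : x₀ ∉ Y) (x : V) (S : ℕ → Set (T ≃g T))
    (hS : ∀ g ∈ rist c F Y, ∃ k, g ∈ S k) :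
    ∃ k n, ∃ y ∈ S k, y ∈ rist c F Y ∧ ∀ s ∈ rist c F Y, (∀ v, T.dist v x ≤ n → s v = v) →
      ∀ m, ∃ z ∈ S k, z ∈ rist c F Y ∧ ∀ v, T.dist v x ≤ m → (y⁻¹ * z) v = s v := by
  have hc := isCompact_rist hT c F hx₀
  have : CompactSpace (rist c F Y) := isCompact_iff_compactSpace.1 hc
  let A : ℕ → Set (rist c F Y) := fun k => closure (Subtype.val ⁻¹' S k)
  obtain ⟨k, ⟨y₀, hy₀⟩⟩ := nonempty_interior_of_iUnion_of_closed (f := A)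
    (fun k => isClosed_closure) (by
      rw [Set.eq_univ_iff_forall]
      rintro ⟨g, hg⟩
      obtain ⟨k, hk⟩ := hS g hg
      exact Set.mem_iUnion.2 ⟨k, subset_closure hk⟩)
  have hdense : ∀ y : rist c F Y, y ∈ A k → ∀ m, ∃ z ∈ S k, z ∈ rist c F Y ∧
      ∀ v, T.dist v x ≤ m → z v = y.1 v := by
    intro y hy m
    have h1 : {g : T ≃g T | ∀ v, T.dist v x ≤ m → g v = y.1 v} ∈ 𝓝 y.1 :=
      (mem_nhds_iff_ball hT c x).2 ⟨m, fun h hh => hh⟩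
    obtain ⟨z, hz1, hz2⟩ := mem_closure_iff_nhds.1 hy _ (continuous_subtype_val.continuousAt h1)
    exact ⟨z.1, hz2, z.2, hz1⟩
  obtain ⟨U, hU, hUA⟩ := mem_nhds_subtype _ _ _ |>.1 (mem_interior_iff_mem_nhds.1 hy₀)
  obtain ⟨n, hn⟩ := (mem_nhds_iff_ball hT c x).1 hU
  -- The interior point `y₀` lies only in the closure of the piece; it is replaced by a member `y`
  -- of the piece agreeing with it on the ball of radius `n`.
  obtain ⟨y, hyS, hyR, hy⟩ := hdense y₀ (interior_subset hy₀) n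
  have hball : ∀ {g : T ≃g T}, g ∈ rist c F Y → (∀ v, T.dist v x ≤ n → g v = y₀.1 v) →
      ∀ hg : g ∈ rist c F Y, (⟨g, hg⟩ : rist c F Y) ∈ A k := fun _ h1 hg => hUA (hn _ h1)
  refine ⟨k, n, y, hyS, hyR, fun s hs hsn m => ?_⟩
  have hys := mul_mem hyR hs
  obtain ⟨z, hzS, hzR, hz⟩ := hdense ⟨y * s, hys⟩ (hball hys (fun v hv => by
    rw [mul_apply', hsn v hv, hy v hv]) hys) m
  refine ⟨z, hzS, hzR, fun v hv => ?_⟩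
  rw [mul_apply', hz v hv]
  exact inv_apply_apply _

/-! ### Products of commutators -/

section comms

open scoped Pointwise commutatorElement

variable {G G' : Type*} [Group G] [Group G']

/-- The set of commutators of elements of a subgroup. -/
def comms (Γ : Subgroup G) : Set G := {g | ∃ a ∈ Γ, ∃ b ∈ Γ, ⁅a, b⁆ = g}

theorem commutator_mem_comms {Γ : Subgroup G} {a b : G} (ha : a ∈ Γ) (hb : b ∈ Γ) :
    ⁅a, b⁆ ∈ comms Γ := ⟨a, ha, b, hb, rfl⟩

theorem one_mem_comms (Γ : Subgroup G) : (1 : G) ∈ comms Γ :=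
  ⟨1, one_mem _, 1, one_mem _, commutatorElement_self 1⟩

theorem comms_pow_mono (Γ : Subgroup G) {m n : ℕ} (h : m ≤ n) : comms Γ ^ m ⊆ comms Γ ^ n :=
  Set.pow_subset_pow_right (one_mem_comms Γ) h

theorem comms_pow_subset (Γ : Subgroup G) (m : ℕ) : comms Γ ^ m ⊆ Γ := by
  induction m with
  | zero => simp
  | succ m ih =>
    rw [pow_succ]
    rintro _ ⟨s, hs, _, ⟨a, ha, b, hb, rfl⟩, rfl⟩
    exact mul_mem (ih hs) (mul_mem (mul_mem (mul_mem ha hb) (inv_mem ha)) (inv_mem hb))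

theorem map_mem_comms_pow (φ : G →* G') {Γ : Subgroup G} {Γ' : Subgroup G'}
    (h : ∀ a ∈ Γ, φ a ∈ Γ') {m : ℕ} : ∀ {s : G}, s ∈ comms Γ ^ m → φ s ∈ comms Γ' ^ m := by
  induction m with
  | zero => simp
  | succ m ih =>
    rw [pow_succ, pow_succ]
    rintro _ ⟨s, hs, _, ⟨a, ha, b, hb, rfl⟩, rfl⟩
    refine ⟨φ s, ih hs, _, ⟨φ a, h a ha, φ b, h b hb, rfl⟩, ?_⟩
    simp only [map_mul, map_commutatorElement]

theorem conj_mem_comms_pow {Γ Γ' : Subgroup G} {g s : G} (h : ∀ a ∈ Γ, g * a * g⁻¹ ∈ Γ')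
    {m : ℕ} (hs : s ∈ comms Γ ^ m) : g * s * g⁻¹ ∈ comms Γ' ^ m :=
  map_mem_comms_pow (MulAut.conj g).toMonoidHom h hs

theorem conj_mem_comms_pow_self {Γ : Subgroup G} {g s : G} (hg : g ∈ Γ)
    {m : ℕ} (hs : s ∈ comms Γ ^ m) : g * s * g⁻¹ ∈ comms Γ ^ m :=
  conj_mem_comms_pow (fun _ ha => mul_mem (mul_mem hg ha) (inv_mem hg)) hs

theorem lift_mem_comms_pow (φ : G →* G') {Γ' : Subgroup G'} (h : ∀ a ∈ Γ', ∃ g, φ g = a)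
    {m : ℕ} : ∀ {a : G'}, a ∈ comms Γ' ^ m → ∃ s ∈ comms (⊤ : Subgroup G) ^ m, φ s = a := by
  induction m with
  | zero =>
    intro a ha
    refine ⟨1, by simp, ?_⟩
    rw [map_one]
    exact (Set.mem_one.1 (by rwa [pow_zero] at ha)).symm
  | succ m ih =>
    rw [pow_succ, pow_succ]
    rintro _ ⟨s, hs, _, ⟨a, ha, b, hb, rfl⟩, rfl⟩
    obtain ⟨s, hs', rfl⟩ := ih hs
    obtain ⟨a, rfl⟩ := h a ha
    obtain ⟨b, rfl⟩ := h b hb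
    refine ⟨s * ⁅a, b⁆, ⟨s, hs', _, commutator_mem_comms trivial trivial, rfl⟩, ?_⟩
    simp only [map_mul, map_commutatorElement]

/-- Commutators in commuting subgroups multiply in parallel, ⁅aa', bb'⁆ = ⁅a, b⁆⁅a', b'⁆, so the
width is not doubled. This keeps the constant in `exists_approx_comms` fixed along the induction. -/
theorem mul_mem_comms_pow_of_commute {Γ₁ Γ₂ Γ : Subgroup G} (h₁ : Γ₁ ≤ Γ) (h₂ : Γ₂ ≤ Γ)
    (h : ∀ a ∈ Γ₁, ∀ b ∈ Γ₂, Commute a b) {m : ℕ} :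
    ∀ {s t : G}, s ∈ comms Γ₁ ^ m → t ∈ comms Γ₂ ^ m → s * t ∈ comms Γ ^ m := by
  induction m with
  | zero =>
    intro s t hs ht
    rw [pow_zero, Set.mem_one] at *
    rw [hs, ht, one_mul]
  | succ m ih =>
    rw [pow_succ, pow_succ, pow_succ]
    rintro _ _ ⟨s, hs, _, ⟨a, ha, b, hb, rfl⟩, rfl⟩ ⟨t, ht, _, ⟨a', ha', b', hb', rfl⟩, rfl⟩
    refine ⟨s * t, ih hs ht, ⁅a * a', b * b'⁆,
      commutator_mem_comms (mul_mem (h₁ ha) (h₂ ha')) (mul_mem (h₁ hb) (h₂ hb')), ?_⟩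
    have e1 : ⁅a * a', b * b'⁆ = ⁅a, b⁆ * ⁅a', b'⁆ := by
      have c1 : a' * b = b * a' := (h b hb a' ha').eq.symm
      have c4 : Commute (a' * b' * a'⁻¹) (a⁻¹) :=
        (((h a ha a' ha').mul_right (h a ha b' hb')).mul_right
          (h a ha a' ha').inv_right).symm.inv_right
      have c5 : Commute (a' * b' * a'⁻¹ * b'⁻¹) (b⁻¹) :=
        ((((h b hb a' ha').mul_right (h b hb b' hb')).mul_right
          (h b hb a' ha').inv_right).mul_right (h b hb b' hb').inv_right).symm.inv_right
      simp only [commutatorElement_def, mul_inv_rev]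
      calc a * a' * (b * b') * (a'⁻¹ * a⁻¹) * (b'⁻¹ * b⁻¹)
          = a * (a' * b) * b' * a'⁻¹ * a⁻¹ * (b'⁻¹ * b⁻¹) := by group
        _ = a * b * ((a' * b' * a'⁻¹) * a⁻¹) * (b'⁻¹ * b⁻¹) := by rw [c1]; group
        _ = a * b * a⁻¹ * ((a' * b' * a'⁻¹ * b'⁻¹) * b⁻¹) := by rw [c4.eq]; group
        _ = a * b * a⁻¹ * b⁻¹ * (a' * b' * a'⁻¹ * b'⁻¹) := by rw [c5.eq]; group
    have e2 : Commute ⁅a, b⁆ t := h _ (comms_pow_subset Γ₁ 1 (by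
      rw [pow_one]; exact commutator_mem_comms ha hb)) _ (comms_pow_subset Γ₂ m ht)
    show s * t * ⁅a * a', b * b'⁆ = s * ⁅a, b⁆ * (t * ⁅a', b'⁆)
    rw [e1, mul_assoc s, mul_assoc s, ← mul_assoc t, ← e2.eq]
    group

/-- Inverses of commutators are commutators, so every element is some product of commutators;
finiteness makes the length uniform. -/
theorem exists_comms_pow_of_perfect [Finite G] [Group.IsPerfect G] :
    ∃ m, ∀ g : G, g ∈ comms (⊤ : Subgroup G) ^ m := by
  have h : ∀ g : G, ∃ m, g ∈ comms (⊤ : Subgroup G) ^ m := by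
    intro g
    have hg : g ∈ commutator G := by
      rw [Group.IsPerfect.commutator_eq_top]
      trivial
    rw [commutator_eq_closure] at hg
    induction hg using Subgroup.closure_induction with
    | mem g hg =>
      obtain ⟨a, b, rfl⟩ := hg
      exact ⟨1, by rw [pow_one]; exact commutator_mem_comms trivial trivial⟩
    | one => exact ⟨0, by simp⟩
    | mul a b _ _ ha hb =>
      obtain ⟨m, hm⟩ := ha
      obtain ⟨n, hn⟩ := hb
      exact ⟨m + n, by rw [pow_add]; exact Set.mul_mem_mul hm hn⟩
    | inv a _ ha =>
      obtain ⟨m, hm⟩ := ha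
      refine ⟨m, ?_⟩
      rw [← Set.inv_mem_inv, inv_inv, ← inv_pow]
      have : (comms (⊤ : Subgroup G))⁻¹ = comms ⊤ := by
        ext g
        rw [Set.mem_inv]
        constructor
        · rintro ⟨a, ha, b, hb, h⟩
          exact ⟨b, hb, a, ha, by rw [← inv_inv g, ← h, commutatorElement_inv]⟩
        · rintro ⟨a, ha, b, hb, h⟩
          exact ⟨b, hb, a, ha, by rw [← h, commutatorElement_inv]⟩
      rwa [this]
  choose m hm using h
  have := Fintype.ofFinite G
  exact ⟨∑ g, m g, fun g => comms_pow_mono _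
    (Finset.single_le_sum (fun _ _ => Nat.zero_le _) (Finset.mem_univ g)) (hm g)⟩

theorem isCompact_comms_pow [TopologicalSpace G] [IsTopologicalGroup G] {Γ : Subgroup G}
    (hΓ : IsCompact (Γ : Set G)) (m : ℕ) : IsCompact (comms Γ ^ m) := by
  have h1 : comms Γ = (fun p : G × G => ⁅p.1, p.2⁆) '' ((Γ : Set G) ×ˢ (Γ : Set G)) := by
    ext g
    simp only [comms, Set.mem_ofPred_eq, Set.mem_image, Set.mem_prod, Prod.exists, SetLike.mem_coe]
    constructor
    · rintro ⟨a, ha, b, hb, h⟩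
      exact ⟨a, b, ⟨ha, hb⟩, h⟩
    · rintro ⟨a, b, ⟨ha, hb⟩, h⟩
      exact ⟨a, ha, b, hb, h⟩
  have h2 : IsCompact (comms Γ) := by
    rw [h1]
    refine (hΓ.prod hΓ).image ?_
    simp only [commutatorElement_def]
    fun_prop
  induction m with
  | zero =>
    rw [pow_zero]
    exact isCompact_singleton
  | succ m ih =>
    rw [pow_succ]
    exact ih.mul h2

end comms

/-! ### Uniform commutator width of rigid stabilizers of half-trees -/

section width

open scoped Pointwise commutatorElement

/-- The stabilizer of `i` in `F`, as a group of permutations. -/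
def pointStab (F : Subgroup (Equiv.Perm (Fin d))) (i : Fin d) : Subgroup (Equiv.Perm (Fin d)) :=
  F ⊓ MulAction.stabilizer (Equiv.Perm (Fin d)) i

theorem exists_pointStab_comms_pow (F : Subgroup (Equiv.Perm (Fin d)))
    (hF : ∀ i : Fin d, Group.IsPerfect (MulAction.stabilizer F i)) :
    ∃ m, ∀ i, ∀ a ∈ pointStab F i, a ∈ comms (pointStab F i) ^ m := by
  have h : ∀ i, ∃ m, ∀ a ∈ pointStab F i, a ∈ comms (pointStab F i) ^ m := by
    intro i
    have := hF i
    obtain ⟨m, hm⟩ := exists_comms_pow_of_perfect (G := MulAction.stabilizer F i)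
    refine ⟨m, fun a ha => ?_⟩
    exact map_mem_comms_pow (F.subtype.comp (MulAction.stabilizer F i).subtype)
      (Γ' := pointStab F i) (fun b _ => ⟨b.1.2, b.2⟩) (hm ⟨⟨a, ha.1⟩, ha.2⟩)
  choose m hm using h
  exact ⟨∑ i, m i, fun i a ha => comms_pow_mono _
    (Finset.single_le_sum (fun _ _ => Nat.zero_le _) (Finset.mem_univ i)) (hm i a ha)⟩

variable {c : Coloring T d} {F : Subgroup (Equiv.Perm (Fin d))}

/-- Two-transitivity in the form that is used below. -/
def PointStabTransitive (F : Subgroup (Equiv.Perm (Fin d))) : Prop :=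
  ∀ i j k : Fin d, j ≠ i → k ≠ i → ∃ a ∈ pointStab F i, a j = k

theorem pointStabTransitive_of_isMultiplyPretransitive
    (h : MulAction.IsMultiplyPretransitive F (Fin d) 2) : PointStabTransitive F := by
  intro i j k hj hk
  obtain ⟨a, h1, h2⟩ := MulAction.is_two_pretransitive_iff.1 h hj.symm hk.symm
  exact ⟨a.1, ⟨a.2, h1⟩, h2⟩

theorem localAction_child {g : T ≃g T} {x y : V} {j k : Fin d} (hx : g x = y)
    (hj : g (c.step x j) = c.step y k) : localAction c g (c.step x j) j = k := by
  have h := apply_step c g (c.step x j) j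
  rw [c.step_step, hx, hj] at h
  apply c.step_injective (c.step y k)
  rw [← h, c.step_step]

theorem conj_mem_rist_half {g h : T ≃g T} {x y : V} {i j : Fin d} (hg : g ∈ universalGroup c F)
    (hx : g x = y) (hi : localAction c g x i = j) (hh : h ∈ rist c F (half c x i)) :
    g * h * g⁻¹ ∈ rist c F (half c y j) := by
  subst hx hi
  exact conj_mem_rist hg hh fun v hv => (apply_mem_half c g).2 hv

theorem conj_mem_rist_child {g h : T ≃g T} {x y : V} {j k : Fin d} (hg : g ∈ universalGroup c F)
    (hx : g x = y) (hj : g (c.step x j) = c.step y k)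
    (hh : h ∈ rist c F (half c (c.step x j) j)) :
    g * h * g⁻¹ ∈ rist c F (half c (c.step y k) k) :=
  conj_mem_rist_half hg hj (localAction_child hx hj) hh

theorem exists_rotation (hT : T.IsTree) (hF : PointStabTransitive F) (c : Coloring T d) (x : V)
    {i j k : Fin d} (hj : j ≠ i) (hk : k ≠ i) :
    ∃ g ∈ rist c F (half c x i), g (c.step x j) = c.step x k := by
  obtain ⟨a, ha, hjk⟩ := hF i j k hj hk
  obtain ⟨g, hg, hga⟩ := exists_lift hT c x ha.1 ha.2
  exact ⟨g, hg, by rw [apply_step, hga, hjk, fix_root hT hg]⟩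

theorem exists_lift_comms_pow (hT : T.IsTree) (x : V) (i : Fin d) {m : ℕ}
    {a : Equiv.Perm (Fin d)} (ha : a ∈ comms (pointStab F i) ^ m) :
    ∃ s ∈ comms (rist c F (half c x i)) ^ m, localAction c s x = a := by
  let φ : rist c F (half c x i) →* Equiv.Perm (Fin d) :=
    { toFun := fun g => localAction c g.1 x
      map_one' := localAction_one c x
      map_mul' := fun g h => by
        show localAction c (g.1 * h.1) x = _
        rw [localAction_mul, fix_root hT h.2] }
  obtain ⟨s, hs, hsa⟩ := lift_mem_comms_pow φ (Γ' := pointStab F i) (fun a ha => by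
    obtain ⟨f, hf, hfa⟩ := exists_lift hT c x ha.1 ha.2
    exact ⟨⟨f, hf⟩, hfa⟩) ha
  exact ⟨s.1, map_mem_comms_pow (rist c F (half c x i)).subtype (fun b _ => b.2) hs, hsa⟩

/-- Modulo few commutators, an element fixing the children of the root is supported in the
half-tree of one child. -/
theorem exists_collect (hT : T.IsTree) (hF : PointStabTransitive F) {x : V} {i j₀ : Fin d}
    (hj₀ : j₀ ≠ i) (J : Finset (Fin d)) (hJ : i ∉ J) :
    ∀ f ∈ rist c F (half c x i), (∀ j, f (c.step x j) = c.step x j) →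
      (∀ j, j ≠ i → j ∉ J → ∀ v ∈ half c (c.step x j) j, f v = v) →
      ∃ w ∈ rist c F (half c (c.step x j₀) j₀), ∃ s ∈ comms (rist c F (half c x i)) ^ J.card,
        f = w * s := by
  induction J using Finset.induction_on with
  | empty =>
    intro f hf _ hf'
    refine ⟨1, one_mem _, 1, by simp, ?_⟩
    ext v
    show f v = v
    by_cases hv : v ∈ half c x i
    · by_cases hx : v = x
      · rw [hx, fix_root hT hf]
      · obtain ⟨j, hj, hvj⟩ := exists_half_child hT c hv hx
        exact hf' j hj (Finset.notMem_empty j) v hvj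
    · exact hf.2 v hv
  | insert j J hjJ ih =>
    intro f hf hf1 hf2
    have hji : j ≠ i := fun h => hJ (h ▸ Finset.mem_insert_self j J)
    have hfx := fix_root hT hf
    obtain ⟨p, hp, hpf⟩ := exists_restrict_half hT c F (x := c.step x j) (i := j) hf.1 (hf1 j)
      (by rw [c.step_step, hfx])
    have hp' : p ∈ rist c F (half c x i) := rist_mono (half_child_subset hT c hji) hp
    have hpfix : ∀ k, k ≠ j → ∀ v ∈ half c (c.step x k) k, p v = v := fun k hk v hv =>
      hp.2 v fun hv' => hk (half_child_disjoint hT c hv hv')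
    have hpk : ∀ k, p (c.step x k) = c.step x k := by
      intro k
      by_cases hk : k = j
      · rw [hk, fix_root hT hp]
      · exact hpfix k hk _ (root_mem_half hT c _ _)
    have hpinv : ∀ {v}, p v = v → p⁻¹ v = v := fun h => inv_apply_eq_iff.2 h.symm
    obtain ⟨w, hw, s, hs, hws⟩ := ih (fun h => hJ (Finset.mem_insert_of_mem h)) (f * p⁻¹)
      (mul_mem hf (inv_mem hp')) (fun k => by rw [mul_apply', hpinv (hpk k), hf1]) (by
        intro k hki hkJ v hv
        rw [mul_apply']
        by_cases hk : k = j
        · subst hk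
          have := (apply_mem_iff_of_mem_rist (inv_mem hp)).2 hv
          rw [← hpf _ this, apply_inv_apply]
        · rw [hpinv (hpfix k hk v hv)]
          exact hf2 k hki (by simp [hk, hkJ]) v hv)
    -- Moving `p` to the child `j₀` costs one commutator: with q = σ⁻¹pσ, p = ⁅σ, q⁆q, so w s p = (w
    -- q) · q⁻¹(s⁅σ, q⁆)q.
    obtain ⟨σ, hσ, hσj⟩ := exists_rotation hT hF c x hj₀ hji
    have hσx : σ⁻¹ x = x := inv_apply_eq_iff.2 (fix_root hT hσ).symm
    have hq : σ⁻¹ * p * σ⁻¹⁻¹ ∈ rist c F (half c (c.step x j₀) j₀) :=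
      conj_mem_rist_child (inv_mem hσ.1) hσx (inv_apply_eq_iff.2 hσj.symm) hp
    have hq' : σ⁻¹ * p * σ⁻¹⁻¹ ∈ rist c F (half c x i) :=
      rist_mono (half_child_subset hT c hj₀) hq
    set q := σ⁻¹ * p * σ⁻¹⁻¹ with hq_def
    refine ⟨w * q, mul_mem hw hq, q⁻¹ * (s * ⁅σ, q⁆) * q⁻¹⁻¹,
      conj_mem_comms_pow_self (inv_mem hq') ?_, ?_⟩
    · rw [Finset.card_insert_of_notMem hjJ, pow_succ]
      exact Set.mul_mem_mul hs (commutator_mem_comms hσ hq')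
    · have h1 : f = w * s * p := by rw [← hws]; group
      rw [h1, commutatorElement_def, hq_def]
      group

/-- Every element of the rigid stabilizer of a half-tree is, up to an element fixing a large ball,
a product of a bounded number of commutators. -/
theorem exists_approx_comms (hT : T.IsTree) (hd : 3 ≤ d) (hF : PointStabTransitive F) {m M : ℕ}
    (hm : ∀ i, ∀ a ∈ pointStab F i, a ∈ comms (pointStab F i) ^ m) (hM : 1 + (d + m) = M) (n : ℕ) :
    ∀ (x : V) (i : Fin d), ∀ w ∈ rist c F (half c x i),
      ∃ s ∈ comms (rist c F (half c x i)) ^ (M + M), ∀ v, T.dist v x ≤ n → s v = w v := by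
  induction n with
  | zero =>
    intro x i w hw
    refine ⟨1, Set.one_mem_pow (one_mem_comms _), fun v hv => ?_⟩
    rw [hT.connected.dist_eq_zero_iff.1 (Nat.le_zero.1 hv), fix_root hT hw]
    rfl
  | succ n ih =>
    intro x i w hw
    obtain ⟨j₀, j₁, hj₀, hj₁, hj⟩ : ∃ j₀ j₁ : Fin d, j₀ ≠ i ∧ j₁ ≠ i ∧ j₀ ≠ j₁ := by
      have h1 : 2 < Fintype.card (Fin d) := by rw [Fintype.card_fin]; omega
      obtain ⟨a, ha⟩ := Fintype.exists_ne_of_one_lt_card (by omega : 1 < Fintype.card (Fin d)) i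
      obtain ⟨b, hb⟩ := Finset.exists_mem_notMem_of_card_lt_card
        (s := {i, a}) (t := (Finset.univ : Finset (Fin d)))
        (by rw [Finset.card_univ]; exact lt_of_le_of_lt Finset.card_le_two h1)
      simp only [Finset.mem_univ, Finset.mem_insert, Finset.mem_singleton, not_or, true_and] at hb
      exact ⟨a, b, ha, hb.1, Ne.symm hb.2⟩
    set R := rist c F (half c x i) with hR
    -- First match the local action of `w` at the root with `m` commutators; then gather the
    -- remainder in the child `j₀` with at most `d` more.
    obtain ⟨s₃, hs₃, hs₃x⟩ := exists_lift_comms_pow (c := c) hT x i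
      (hm i (localAction c w x) ⟨hw.1 x, localAction_root hT hw⟩)
    have hs₃R : s₃ ∈ R := comms_pow_subset _ _ hs₃
    have hs₃x' : s₃⁻¹ x = x := inv_apply_eq_iff.2 (fix_root hT hs₃R).symm
    have hfix : ∀ j, (w * s₃⁻¹) (c.step x j) = c.step x j := by
      intro j
      obtain ⟨k, hk⟩ := (localAction c s₃ x).surjective j
      have h1 := apply_step c s₃ x k
      rw [hk, fix_root hT hs₃R] at h1
      rw [mul_apply', ← h1, inv_apply_apply, apply_step, fix_root hT hw, ← hs₃x, hk, h1]
    obtain ⟨w', hw', s₁, hs₁, h1⟩ := exists_collect hT hF hj₀ (Finset.univ.erase i)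
      (Finset.notMem_erase i _) (w * s₃⁻¹) (mul_mem hw (inv_mem hs₃R)) hfix
      (fun j hji hj => absurd (Finset.mem_erase.2 ⟨hji, Finset.mem_univ j⟩) hj)
    have hs₁' : s₁ ∈ comms R ^ d := comms_pow_mono R (by
      refine (Finset.card_le_univ _).trans ?_
      rw [Fintype.card_fin]) hs₁
    have hs₁R : s₁ ∈ R := comms_pow_subset _ _ hs₁
    obtain ⟨s, hs, hsw⟩ := ih (c.step x j₀) j₀ w' hw'
    set R₀ := rist c F (half c (c.step x j₀) j₀) with hR₀
    have hR₀R : R₀ ≤ R := rist_mono (half_child_subset hT c hj₀)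
    have hR₁R : rist c F (half c (c.step x j₁) j₁) ≤ R := rist_mono (half_child_subset hT c hj₁)
    have hsR : s ∈ R₀ := comms_pow_subset _ _ hs
    rw [pow_add] at hs
    -- Halve the 2M commutators of the child and rotate the second half to the disjoint child `j₁`.
    -- The two halves then merge into M commutators, and t₁ = t₂⁅t₂⁻¹, σ⁻¹⁆ with t₂ = σt₁σ⁻¹ costs
    -- one more. With the d + m corrections this again gives M + M.
    obtain ⟨t₀, ht₀, t₁, ht₁, rfl⟩ := hs
    dsimp only at hsw hsR
    have he : (t₀ * t₁)⁻¹ * w' ∈ R₀ := mul_mem (inv_mem hsR) hw'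
    obtain ⟨σ, hσ, hσj⟩ := exists_rotation hT hF c x hj₀ hj₁
    have ht₂ : σ * t₁ * σ⁻¹ ∈ comms (rist c F (half c (c.step x j₁) j₁)) ^ M :=
      conj_mem_comms_pow (fun a ha => conj_mem_rist_child hσ.1 (fix_root hT hσ) hσj ha) ht₁
    have ht₂R : σ * t₁ * σ⁻¹ ∈ R := hR₁R (comms_pow_subset _ _ ht₂)
    have ht : t₀ * (σ * t₁ * σ⁻¹) ∈ comms R ^ M := by
      refine mul_mem_comms_pow_of_commute hR₀R hR₁R (fun a ha b hb => ?_) ht₀ ht₂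
      refine commute_of_disjoint ha hb ?_
      rw [Set.disjoint_left]
      exact fun v h0 h1 => hj (half_child_disjoint hT c h0 h1)
    set e := (t₀ * t₁)⁻¹ * w' with he_def
    have hr : ⁅(σ * t₁ * σ⁻¹)⁻¹, σ⁻¹⁆ * (e * (s₁ * s₃) * e⁻¹) ∈ comms R ^ M := by
      rw [← hM, pow_add, pow_one, pow_add]
      refine Set.mul_mem_mul (commutator_mem_comms (inv_mem ht₂R) (inv_mem hσ)) ?_
      rw [← pow_add]
      refine conj_mem_comms_pow_self (hR₀R he) ?_
      rw [pow_add]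
      exact Set.mul_mem_mul hs₁' hs₃
    have hprod := Set.mul_mem_mul ht hr
    rw [← pow_add] at hprod
    refine ⟨_, hprod, fun v hv => ?_⟩
    have hev : e v = v := by
      by_cases hvj : v ∈ half c (c.step x j₀) j₀
      · rw [he_def, mul_apply', inv_apply_eq_iff]
        refine (hsw v ?_).symm
        rw [mem_half, c.step_step] at hvj
        omega
      · exact he.2 v hvj
    have hw_eq : w = t₀ * (σ * t₁ * σ⁻¹) *
        (⁅(σ * t₁ * σ⁻¹)⁻¹, σ⁻¹⁆ * (e * (s₁ * s₃) * e⁻¹)) * e := by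
      have h2 : w = w' * s₁ * s₃ := by rw [← h1]; group
      rw [h2, commutatorElement_def, he_def]
      group
    conv_rhs => rw [hw_eq, mul_apply', hev]

/-- The products of boundedly many commutators form a compact, hence closed, set, and
`exists_approx_comms` shows that it is dense. -/
theorem exists_comms_pow_rist_half (hT : T.IsTree) (c : Coloring T d) (hd : 3 ≤ d)
    (hF : PointStabTransitive F)
    (hF' : ∀ i : Fin d, Group.IsPerfect (MulAction.stabilizer F i)) :
    ∃ M, ∀ (x : V) (i : Fin d), ∀ w ∈ rist c F (half c x i),
      w ∈ comms (rist c F (half c x i)) ^ M := by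
  obtain ⟨m, hm⟩ := exists_pointStab_comms_pow F hF'
  refine ⟨(1 + (d + m)) + (1 + (d + m)), fun x i w hw => ?_⟩
  have hc := (isCompact_comms_pow (isCompact_rist hT c F (step_not_mem_half hT c x i))
    ((1 + (d + m)) + (1 + (d + m)))).isClosed
  rw [← hc.closure_eq, mem_closure_iff_nhds]
  intro U hU
  obtain ⟨n, hn⟩ := (mem_nhds_iff_ball hT c x).1 hU
  obtain ⟨s, hs, hsw⟩ := exists_approx_comms hT hd hF hm rfl n x i w hw
  exact ⟨s, hn s hsw, hs⟩

end width

/-! ### Small conjugates generate neighborhoods of the identity -/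

section core

open scoped Pointwise commutatorElement

variable {c : Coloring T d} {F : Subgroup (Equiv.Perm (Fin d))}

/-- Because the length `m` is the same on every half-tree of the family, the entries of the
commutators can be glued one position at a time. -/
theorem exists_comms_pow_glue (hT : T.IsTree) (A : Set (V × Fin d))
    (hA : ∀ p ∈ A, ∀ q ∈ A, ∀ v, v ∈ half c p.1 p.2 → v ∈ half c q.1 q.2 → p = q) {m : ℕ} :
    ∀ t : V × Fin d → T ≃g T, (∀ p ∈ A, t p ∈ comms (rist c F (half c p.1 p.2)) ^ m) →
      ∃ f ∈ comms (rist c F (⋃ p ∈ A, half c p.1 p.2)) ^ m,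
        ∀ p ∈ A, ∀ v ∈ half c p.1 p.2, f v = t p v := by
  induction m with
  | zero =>
    intro t ht
    refine ⟨1, by simp, fun p hp v _ => ?_⟩
    have h := ht p hp
    rw [pow_zero, Set.mem_one] at h
    rw [h]
  | succ m ih =>
    intro t ht
    have h1 : ∀ p, ∃ q : (T ≃g T) × (T ≃g T) × (T ≃g T), p ∈ A →
        q.1 ∈ comms (rist c F (half c p.1 p.2)) ^ m ∧ q.2.1 ∈ rist c F (half c p.1 p.2) ∧
          q.2.2 ∈ rist c F (half c p.1 p.2) ∧ t p = q.1 * ⁅q.2.1, q.2.2⁆ := by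
      intro p
      by_cases hp : p ∈ A
      · have h2 := ht p hp
        rw [pow_succ] at h2
        obtain ⟨s, hs, _, ⟨a, ha, b, hb, rfl⟩, h3⟩ := h2
        exact ⟨(s, a, b), fun _ => ⟨hs, ha, hb, h3.symm⟩⟩
      · exact ⟨(1, 1, 1), fun h => absurd h hp⟩
    choose q hq using h1
    obtain ⟨s, hs, hs'⟩ := ih (fun p => (q p).1) (fun p hp => (hq p hp).1)
    obtain ⟨a, ha, ha'⟩ := exists_glue_half hT c F A hA (fun p => (q p).2.1)
      (fun p hp => (hq p hp).2.1)
    obtain ⟨b, hb, hb'⟩ := exists_glue_half hT c F A hA (fun p => (q p).2.2)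
      (fun p hp => (hq p hp).2.2.1)
    have hinv : ∀ {f g : T ≃g T} {Y : Set V}, g ∈ rist c F Y → (∀ v ∈ Y, f v = g v) →
        ∀ v ∈ Y, f⁻¹ v = g⁻¹ v := by
      intro f g Y hg h v hv
      rw [inv_apply_eq_iff, h _ ((apply_mem_iff_of_mem_rist (inv_mem hg)).2 hv), apply_inv_apply]
    refine ⟨s * ⁅a, b⁆, ?_, fun p hp v hv => ?_⟩
    · rw [pow_succ]
      exact Set.mul_mem_mul hs (commutator_mem_comms ha hb)
    · obtain ⟨_, h2, h3, h4⟩ := hq p hp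
      have e1 : b⁻¹ v = (q p).2.2⁻¹ v := hinv h3 (hb' p hp) v hv
      have m1 := (apply_mem_iff_of_mem_rist (inv_mem h3)).2 hv
      have e2 := hinv h2 (ha' p hp) _ m1
      have m2 := (apply_mem_iff_of_mem_rist (inv_mem h2)).2 m1
      have e3 := hb' p hp _ m2
      have m3 := (apply_mem_iff_of_mem_rist h3).2 m2
      have e4 := ha' p hp _ m3
      have m4 := (apply_mem_iff_of_mem_rist h2).2 m3
      have e5 := hs' p hp _ m4
      rw [h4]
      simp only [commutatorElement_def, mul_apply']
      rw [e1, e2, e3, e4, e5]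

/-- Since `x` moves Y off itself, xa⁻¹x⁻¹ is supported outside Y and commutes with aba⁻¹. Inserting
it expresses ⁅a, b⁆ by four conjugates of x and x⁻¹. -/
theorem comms_pow_subset_pow {Y : Set V} {x : T ≃g T} {N : Set (T ≃g T)}
    (hx : x ∈ universalGroup c F) (hxY : ∀ v ∈ Y, x v ∉ Y)
    (hN : ∀ r ∈ rist c F Y, r * x * r⁻¹ ∈ N ∧ r * x⁻¹ * r⁻¹ ∈ N) (m : ℕ) :
    comms (rist c F Y) ^ m ⊆ N ^ (4 * m) := by
  have h1 : comms (rist c F Y) ⊆ N ^ 4 := by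
    rintro _ ⟨a, ha, b, hb, rfl⟩
    have hu : x * a⁻¹ * x⁻¹ ∈ rist c F Yᶜ :=
      conj_mem_rist hx (inv_mem ha) fun v hv => hxY v hv
    have hcomm := commute_of_disjoint hu (mul_mem (mul_mem ha hb) (inv_mem ha))
      disjoint_compl_left
    have e : ⁅a, b⁆ = (1 * x * 1⁻¹) * (a⁻¹ * x⁻¹ * a⁻¹⁻¹) * ((b * a⁻¹) * x * (b * a⁻¹)⁻¹) *
        (b * x⁻¹ * b⁻¹) := by
      calc ⁅a, b⁆ = (a * b * a⁻¹) * (x * a⁻¹ * x⁻¹) * (x * a⁻¹ * x⁻¹)⁻¹ * b⁻¹ := by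
            rw [commutatorElement_def]; group
        _ = (x * a⁻¹ * x⁻¹) * (a * b * a⁻¹) * (x * a⁻¹ * x⁻¹)⁻¹ * b⁻¹ := by rw [hcomm]
        _ = _ := by group
    rw [e, pow_succ, pow_succ, pow_succ, pow_one]
    exact Set.mul_mem_mul (Set.mul_mem_mul (Set.mul_mem_mul (hN 1 (one_mem _)).1
      (hN _ (inv_mem ha)).2) (hN _ (mul_mem hb (inv_mem ha))).1) (hN b hb).2
  rw [pow_mul]
  exact Set.pow_subset_pow_left h1

/-! ### Displacing the color classes of a level -/

theorem child_mem_level {x : V} {i j : Fin d} {n : ℕ} {p : V × Fin d} (hp : p ∈ level c x i n)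
    (hj : j ≠ p.2) : (c.step p.1 j, j) ∈ level c x i (n + 1) := ⟨p, hp, j, hj, rfl⟩

/-- The half-trees `n` levels below `half c x i` whose root edge has color `j`. -/
def colorClass (c : Coloring T d) (x : V) (i : Fin d) (n : ℕ) (j : Fin d) : Set V :=
  ⋃ p ∈ {p | p ∈ level c x i n ∧ p.2 = j}, half c p.1 p.2

theorem mem_colorClass {x v : V} {i j : Fin d} {n : ℕ} :
    v ∈ colorClass c x i n j ↔ ∃ p ∈ level c x i n, p.2 = j ∧ v ∈ half c p.1 p.2 := by
  simp only [colorClass, Set.mem_iUnion, Set.mem_ofPred_eq, exists_prop, and_assoc]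

theorem colorClass_subset (hT : T.IsTree) {x : V} {i j : Fin d} {n : ℕ} :
    colorClass c x i n j ⊆ half c x i := by
  intro v hv
  obtain ⟨p, hp, _, hvp⟩ := mem_colorClass.1 hv
  exact level_half_subset hT c hp hvp

theorem exists_ne_ne (hd : 3 ≤ d) (i j : Fin d) : ∃ k : Fin d, k ≠ i ∧ k ≠ j := by
  obtain ⟨b, hb⟩ := Finset.exists_mem_notMem_of_card_lt_card
    (s := {i, j}) (t := (Finset.univ : Finset (Fin d)))
    (by
      rw [Finset.card_univ, Fintype.card_fin]
      exact lt_of_le_of_lt Finset.card_le_two hd)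
  simp only [Finset.mem_univ, Finset.mem_insert, Finset.mem_singleton, not_or, true_and] at hb
  exact ⟨b, hb⟩

/-- There are elements fixing a ball and moving all half-trees of a given color just outside. -/
theorem exists_mover (hT : T.IsTree) (hd : 3 ≤ d) (hF : PointStabTransitive F) (x : V) (i : Fin d)
    (n : ℕ) (j : Fin d) :
    ∃ s ∈ rist c F (half c x i), (∀ v, T.dist v x ≤ n → s v = v) ∧
      ∀ p ∈ level c x i n, p.2 ≠ j → ∃ k, k ≠ j ∧ k ≠ p.2 ∧ s (c.step p.1 j) = c.step p.1 k := by
  have h1 : ∀ p : V × Fin d, ∃ s ∈ rist c F (half c p.1 p.2),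
      p.2 ≠ j → ∃ k, k ≠ j ∧ k ≠ p.2 ∧ s (c.step p.1 j) = c.step p.1 k := by
    intro p
    by_cases hp : p.2 = j
    · exact ⟨1, one_mem _, fun h => absurd hp h⟩
    · obtain ⟨k, hk1, hk2⟩ := exists_ne_ne hd j p.2
      obtain ⟨s, hs, h⟩ := exists_rotation hT hF c p.1 (Ne.symm hp) hk2
      exact ⟨s, hs, fun _ => ⟨k, hk1, hk2, h⟩⟩
  choose t ht ht' using h1
  obtain ⟨s, hs, hs'⟩ := exists_glue_half hT c F (level c x i n)
    (fun p hp q hq v => level_disjoint hT c hp hq) t (fun p _ => ht p)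
  have hsub : ⋃ p ∈ level c x i n, half c p.1 p.2 ⊆ half c x i := by
    intro v hv
    simp only [Set.mem_iUnion, exists_prop] at hv
    obtain ⟨p, hp, hvp⟩ := hv
    exact level_half_subset hT c hp hvp
  refine ⟨s, rist_mono hsub hs, fun v hv => ?_, fun p hp hpj => ?_⟩
  · by_cases hvp : v ∈ ⋃ p ∈ level c x i n, half c p.1 p.2
    · simp only [Set.mem_iUnion, exists_prop] at hvp
      obtain ⟨p, hp, hvp⟩ := hvp
      have h2 := dist_of_mem_level hT c hp hvp
      have h3 : v = p.1 := hT.connected.dist_eq_zero_iff.1 (by omega)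
      rw [hs' p hp v hvp, h3, fix_root hT (ht p)]
    · exact hs.2 v hvp
  · obtain ⟨k, hk1, hk2, hk⟩ := ht' p hpj
    refine ⟨k, hk1, hk2, ?_⟩
    rw [hs' p hp _ (half_child_subset hT c (Ne.symm hpj) (root_mem_half hT c _ _)), hk]

theorem exists_restrict_colorClass (hT : T.IsTree) {M : ℕ}
    (hM : ∀ (x : V) (i : Fin d), ∀ w ∈ rist c F (half c x i),
      w ∈ comms (rist c F (half c x i)) ^ M) {x : V} {i : Fin d} {n : ℕ} {g : T ≃g T}
    (hg : g ∈ universalGroup c F) (hgn : ∀ v, T.dist v x ≤ n + 1 → g v = v) (j : Fin d) :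
    ∃ f ∈ comms (rist c F (colorClass c x i (n + 1) j)) ^ M,
      ∀ v ∈ colorClass c x i (n + 1) j, f v = g v := by
  have h1 : ∀ p, ∃ f : T ≃g T, p ∈ level c x i (n + 1) →
      f ∈ rist c F (half c p.1 p.2) ∧ ∀ v ∈ half c p.1 p.2, f v = g v := by
    intro p
    by_cases hp : p ∈ level c x i (n + 1)
    · have hroot := hgn p.1 (level_dist hT c hp).le
      have hpar : g (c.step p.1 p.2) = c.step p.1 p.2 := by
        obtain ⟨q, hq, k, hk, rfl⟩ := hp
        dsimp only
        rw [c.step_step]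
        refine hgn _ ?_
        rw [level_dist hT c hq]
        omega
      obtain ⟨f, hf, hf'⟩ := exists_restrict_half hT c F hg hroot hpar
      exact ⟨f, fun _ => ⟨hf, hf'⟩⟩
    · exact ⟨1, fun h => absurd h hp⟩
  choose t ht using h1
  obtain ⟨f, hf, hf'⟩ := exists_comms_pow_glue hT {p | p ∈ level c x i (n + 1) ∧ p.2 = j}
    (fun p hp q hq v => level_disjoint hT c hp.1 hq.1) t (fun p hp => hM _ _ _ (ht p hp.1).1)
  refine ⟨f, hf, fun v hv => ?_⟩
  obtain ⟨p, hp, hpj, hvp⟩ := mem_colorClass.1 hv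
  rw [hf' p ⟨hp, hpj⟩ v hvp, (ht p hp).2 v hvp]

/-- If countably many left translates of a set cover the rigid stabilizer of a half-tree, then
products of boundedly many conjugates of small elements contain a neighborhood of the identity. -/
theorem exists_ball_subset_pow (hT : T.IsTree) (hd : 3 ≤ d) (hF : PointStabTransitive F) {M : ℕ}
    (hM : ∀ (x : V) (i : Fin d), ∀ w ∈ rist c F (half c x i),
      w ∈ comms (rist c F (half c x i)) ^ M) (x : V) (i : Fin d) (S : ℕ → Set (T ≃g T))
    (N : Set (T ≃g T)) (hS : ∀ g ∈ rist c F (half c x i), ∃ k, g ∈ S k)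
    (hN : ∀ k, ∀ y ∈ S k, ∀ z ∈ S k, y ∈ rist c F (half c x i) → z ∈ rist c F (half c x i) →
      ∀ r ∈ rist c F (half c x i), r * (y⁻¹ * z) * r⁻¹ ∈ N) :
    ∃ n, ∀ g ∈ rist c F (half c x i), (∀ v, T.dist v x ≤ n → g v = v) →
      g ∈ N ^ (4 * M * d) := by
  obtain ⟨k, n, y, hyS, hyR, hy⟩ := exists_dense_piece hT c F (step_not_mem_half hT c x i) x S hS
  have hclass : ∀ j, comms (rist c F (colorClass c x i (n + 1) j)) ^ M ⊆ N ^ (4 * M) := by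
    intro j
    obtain ⟨s, hs, hsn, hsj⟩ := exists_mover hT hd hF x i n j (c := c)
    -- Agreement with `s` up to radius n + 1 determines where the roots of level n + 1 and their
    -- parents go, so `y⁻¹ * z` displaces the entire color class.
    obtain ⟨z, hzS, hzR, hz⟩ := hy s hs hsn (n + 1)
    refine comms_pow_subset_pow (x := y⁻¹ * z) (mul_mem (inv_mem hyR) hzR).1 ?_ ?_ M
    · intro v hv hv'
      obtain ⟨p, ⟨q, hq, l, hl, rfl⟩, hpj, hvp⟩ := mem_colorClass.1 hv
      dsimp only at hpj hvp
      subst hpj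
      obtain ⟨k, hkl, hkq, hk⟩ := hsj q hq hl.symm
      have hdq := level_dist hT c hq
      have h1 : (y⁻¹ * z) q.1 = q.1 := by
        rw [hz q.1 (by omega), hsn q.1 hdq.le]
      have h2 : (y⁻¹ * z) (c.step q.1 l) = c.step q.1 k := by
        rw [hz, hk]
        exact (level_dist hT c (child_mem_level hq hl)).le
      have h3 : (y⁻¹ * z) v ∈ half c (c.step q.1 k) k := by
        have := (apply_mem_half c (y⁻¹ * z)).2 hvp
        rwa [localAction_child h1 h2, h2] at this
      obtain ⟨p, hp, hpl, hvp'⟩ := mem_colorClass.1 hv'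
      have h4 := level_disjoint hT c (child_mem_level hq hkq) hp h3 hvp'
      rw [← h4] at hpl
      exact hkl hpl
    · intro r hr
      have hr' := rist_mono (colorClass_subset hT) hr
      refine ⟨hN k y hyS z hzS hyR hzR r hr', ?_⟩
      rw [mul_inv_rev, inv_inv]
      exact hN k z hzS y hyS hzR hyR r hr'
  -- Split off one color class at a time; `J` holds the colors on which `g` may still be nontrivial.
  have key : ∀ J : Finset (Fin d), ∀ g ∈ rist c F (half c x i),
      (∀ v, T.dist v x ≤ n + 1 → g v = v) →
      (∀ j, j ∉ J → ∀ v ∈ colorClass c x i (n + 1) j, g v = v) → g ∈ N ^ (4 * M * J.card) := by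
    intro J
    induction J using Finset.induction_on with
    | empty =>
      intro g hg hgn hgJ
      rw [Finset.card_empty, mul_zero, pow_zero, Set.mem_one]
      ext v
      show g v = v
      by_cases hv : v ∈ half c x i
      · by_cases hvn : T.dist v x ≤ n + 1
        · exact hgn v hvn
        · obtain ⟨p, hp, hvp⟩ := exists_level hT c hv (n + 1) (by omega)
          exact hgJ p.2 (Finset.notMem_empty _) v (mem_colorClass.2 ⟨p, hp, rfl, hvp⟩)
      · exact hg.2 v hv
    | insert j J hjJ ih =>
      intro g hg hgn hgJ
      obtain ⟨f, hf, hfg⟩ := exists_restrict_colorClass hT hM (i := i) hg.1 hgn j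
      have hfR := comms_pow_subset _ _ hf
      have hfR' : f ∈ rist c F (half c x i) := rist_mono (colorClass_subset hT) hfR
      have h1 : ∀ v ∈ colorClass c x i (n + 1) j, (g * f⁻¹) v = v := by
        intro v hv
        rw [mul_apply', ← hfg _ ((apply_mem_iff_of_mem_rist (inv_mem hfR)).2 hv),
          apply_inv_apply]
      have h2 : ∀ v, v ∉ colorClass c x i (n + 1) j → (g * f⁻¹) v = g v := by
        intro v hv
        rw [mul_apply', (inv_mem hfR).2 v hv]
      have h3 : g * f⁻¹ ∈ N ^ (4 * M * J.card) := by
        refine ih _ (mul_mem hg (inv_mem hfR')) (fun v hv => ?_) fun l hl v hv => ?_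
        · by_cases hvj : v ∈ colorClass c x i (n + 1) j
          · exact h1 v hvj
          · rw [h2 v hvj, hgn v hv]
        · by_cases hvj : v ∈ colorClass c x i (n + 1) j
          · exact h1 v hvj
          · rw [h2 v hvj]
            refine hgJ l ?_ v hv
            rw [Finset.mem_insert, not_or]
            refine ⟨?_, hl⟩
            rintro rfl
            exact hvj hv
      have h4 := Set.mul_mem_mul h3 (hclass j hf)
      rw [inv_mul_cancel_right, ← pow_add] at h4
      rwa [Finset.card_insert_of_notMem hjJ, mul_add, mul_one]
  refine ⟨n + 1, fun g hg hgn => ?_⟩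
  have h := key Finset.univ g hg hgn fun j hj => absurd (Finset.mem_univ j) hj
  rwa [Finset.card_univ, Fintype.card_fin] at h

end core

section full

variable {c : Coloring T d} {F : Subgroup (Equiv.Perm (Fin d))}

/-! ### Pieces of countable covers are full for some half-tree -/

/-- Every half-tree contains an infinite sequence of disjoint half-trees. -/
theorem exists_disjoint_sequence (hT : T.IsTree) (hd : 3 ≤ d) (x : V) (i : Fin d) :
    ∃ E : ℕ → V × Fin d, (∀ n, E n ∈ level c x i (n + 1)) ∧
      ∀ m n v, v ∈ half c (E m).1 (E m).2 → v ∈ half c (E n).1 (E n).2 → m = n := by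
  -- The color `a` continues a ray downwards; `b` picks the side branch leaving it. Distinct side
  -- branches are disjoint.
  choose a ha _ using fun j : Fin d => exists_ne_ne hd j j
  choose b hb hb' using fun j : Fin d => exists_ne_ne hd j (a j)
  let ray : ℕ → V × Fin d := fun n =>
    Nat.rec (x, i) (fun _ p => (c.step p.1 (a p.2), a p.2)) n
  have hray : ∀ n, ray n ∈ level c x i n := by
    intro n
    induction n with
    | zero => exact rfl
    | succ n ih => exact child_mem_level ih (ha _)
  have hanti : Antitone fun n => half c (ray n).1 (ray n).2 :=
    antitone_nat_of_succ_le fun n => half_child_subset hT c (ha _)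
  refine ⟨fun n => (c.step (ray n).1 (b (ray n).2), b (ray n).2),
    fun n => child_mem_level (hray n) (hb _), ?_⟩
  have key : ∀ m n v, m < n → v ∈ half c (c.step (ray m).1 (b (ray m).2)) (b (ray m).2) →
      v ∉ half c (c.step (ray n).1 (b (ray n).2)) (b (ray n).2) := by
    intro m n v hmn hm hn
    have h1 : v ∈ half c (c.step (ray m).1 (a (ray m).2)) (a (ray m).2) :=
      hanti (Nat.succ_le_of_lt hmn) (half_child_subset hT c (hb _) hn)
    exact hb' _ (half_child_disjoint hT c hm h1)
  intro m n v hm hn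
  rcases lt_trichotomy m n with h | h | h
  · exact absurd hn (key m n v h hm)
  · exact h
  · exact absurd hm (key n m v h hn)

/-- Given a countable cover of `U(F)⁺`, below each half-tree there is a half-tree such that each
element of its rigid stabilizer coincides on it with a quotient of two elements of the same piece
of the cover. -/
theorem exists_full (hT : T.IsTree) (hd : 3 ≤ d) (x : V) (i : Fin d) (S : ℕ → Set (T ≃g T))
    (hS : ∀ g ∈ universalGroupPlus c F, ∃ k, g ∈ S k) :
    ∃ n, ∃ q ∈ level c x i n, ∃ k, ∀ r ∈ rist c F (half c q.1 q.2), ∃ b' ∈ S k, ∃ b ∈ S k,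
      ∀ v ∈ half c q.1 q.2, (b'⁻¹ * b) v = r v := by
  obtain ⟨E, hE, hdisj⟩ := exists_disjoint_sequence (c := c) hT hd x i
  have hEinj : Function.Injective E := by
    intro m n h
    refine hdisj m n (E m).1 (root_mem_half hT c _ _) ?_
    rw [h]
    exact root_mem_half hT c _ _
  obtain ⟨k, hk⟩ : ∃ k, ∀ r ∈ rist c F (half c (E k).1 (E k).2), ∃ b ∈ S k,
      ∀ v ∈ half c (E k).1 (E k).2, b v = r v := by
    -- Diagonal argument: if for every k some `r k` on the k-th half-tree is matched by no element
    -- of `S k`, gluing all `r k` gives an element of U(F)⁺ that belongs to no piece.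
    by_contra! hcon
    choose r hr hr' using hcon
    have hinv := Function.leftInverse_invFun hEinj
    obtain ⟨f, hf, hf'⟩ := exists_glue_half hT c F (Set.range E) (by
      rintro _ ⟨m, rfl⟩ _ ⟨n, rfl⟩ v hm hn
      rw [hdisj m n v hm hn]) (fun p => r (Function.invFun E p)) (by
      rintro _ ⟨n, rfl⟩
      rw [hinv n]
      exact hr n)
    have hsub : ⋃ p ∈ Set.range E, half c p.1 p.2 ⊆ half c x i := by
      intro v hv
      simp only [Set.mem_iUnion, exists_prop] at hv
      obtain ⟨_, ⟨n, rfl⟩, hv⟩ := hv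
      exact level_half_subset hT c (hE n) hv
    obtain ⟨k, hk⟩ := hS f (mem_universalGroupPlus_of_rist_half hT (rist_mono hsub hf))
    obtain ⟨v, hv, hne⟩ := hr' k f hk
    refine hne ?_
    rw [hf' (E k) ⟨k, rfl⟩ v hv, hinv k]
  refine ⟨k + 1, E k, hE k, k, fun r hr => ?_⟩
  obtain ⟨b', hb', hb'1⟩ := hk 1 (one_mem _)
  obtain ⟨b, hb, hbr⟩ := hk r hr
  refine ⟨b', hb', b, hb, fun v hv => ?_⟩
  rw [mul_apply', hbr v hv, inv_apply_eq_iff,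
    hb'1 _ ((apply_mem_iff_of_mem_rist hr).2 hv)]
  rfl

/-- The element r⁻¹b fixes Y pointwise and so commutes with `y`. This allows replacing an arbitrary
conjugator by a controlled one. -/
theorem conj_eq_of_agree {Y : Set V} {y r b : T ≃g T} (hy : y ∈ rist c F Y)
    (hb : ∀ v ∈ Y, b v = r v) : r * y * r⁻¹ = b * y * b⁻¹ := by
  have h1 : ∀ v ∈ Y, (r⁻¹ * b) v = v := fun v hv => by
    rw [mul_apply', hb v hv, inv_apply_apply]
  have h2 : (r⁻¹ * b) * y = y * (r⁻¹ * b) := by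
    ext v
    rw [mul_apply', mul_apply' (g := y)]
    by_cases hv : v ∈ Y
    · rw [h1 v hv, h1 _ ((apply_mem_iff_of_mem_rist hy).2 hv)]
    · have : (r⁻¹ * b) v ∉ Y := by
        intro hY
        have := (r⁻¹ * b).injective (h1 _ hY)
        rw [this] at hY
        exact hv hY
      rw [hy.2 v hv, hy.2 _ this]
  calc r * y * r⁻¹ = r * (y * (r⁻¹ * b)) * b⁻¹ := by group
    _ = b * y * b⁻¹ := by rw [← h2]; group

/-! ### From half-trees to edges -/

theorem universalGroupPlus_le : universalGroupPlus c F ≤ universalGroup c F :=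
  (Subgroup.closure_le _).2 fun _ hg => hg.1

/-- The pointwise stabilizer of an edge is the product of the rigid stabilizers of the two
half-trees. -/
theorem exists_split_edge (hT : T.IsTree) {x : V} {i : Fin d} {g : T ≃g T}
    (hg : g ∈ universalGroup c F) (hx : g x = x) (hx' : g (c.step x i) = c.step x i) :
    ∃ g₁ ∈ rist c F (half c x i), ∃ g₂ ∈ rist c F (half c (c.step x i) i), g = g₂ * g₁ ∧
      ∀ v, g v = v → g₁ v = v ∧ g₂ v = v := by
  obtain ⟨f, hf, hfg⟩ := exists_restrict_half hT c F hg hx hx'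
  have h1 : ∀ v, g v = v → f v = v := by
    intro v hv
    by_cases h : v ∈ half c x i
    · rw [hfg v h, hv]
    · exact hf.2 v h
  refine ⟨f, hf, g * f⁻¹, ⟨mul_mem hg (inv_mem hf.1), fun v hv => ?_⟩, by group, fun v hv =>
    ⟨h1 v hv, ?_⟩⟩
  · rw [← not_mem_half_iff hT, not_not] at hv
    rw [mul_apply', ← hfg _ ((apply_mem_iff_of_mem_rist (inv_mem hf)).2 hv), apply_inv_apply]
  · rw [mul_apply', inv_apply_eq_iff.2 (h1 v hv).symm, hv]

/-- A subgroup containing neighborhoods of the identity of the rigid stabilizers of all children of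
a half-tree contains one for the half-tree itself. -/
theorem exists_ball_of_children (hT : T.IsTree) (K : Subgroup (T ≃g T)) {x : V} {i : Fin d}
    (h : ∀ j, j ≠ i → ∃ n, ∀ g ∈ rist c F (half c (c.step x j) j),
      (∀ v, T.dist v (c.step x j) ≤ n → g v = v) → g ∈ K) :
    ∃ n, ∀ g ∈ rist c F (half c x i), (∀ v, T.dist v x ≤ n → g v = v) → g ∈ K := by
  have h' : ∀ j, ∃ n, j ≠ i → ∀ g ∈ rist c F (half c (c.step x j) j),
      (∀ v, T.dist v (c.step x j) ≤ n → g v = v) → g ∈ K := by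
    intro j
    by_cases hj : j = i
    · exact ⟨0, fun h => absurd hj h⟩
    · obtain ⟨n, hn⟩ := h j hj
      exact ⟨n, fun _ => hn⟩
  choose n hn using h'
  have hle : ∀ j, n j ≤ ∑ j, n j := fun j =>
    Finset.single_le_sum (fun _ _ => Nat.zero_le _) (Finset.mem_univ j)
  -- The sum bounds all the radii `n j`, and the extra 1 accounts for the distance from `x` to its
  -- children.
  have key : ∀ J : Finset (Fin d), ∀ g ∈ rist c F (half c x i),
      (∀ v, T.dist v x ≤ ∑ j, n j + 1 → g v = v) →
      (∀ j, j ≠ i → j ∉ J → ∀ v ∈ half c (c.step x j) j, g v = v) → g ∈ K := by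
    intro J
    induction J using Finset.induction_on with
    | empty =>
      intro g hg hgn hgJ
      have : g = 1 := by
        ext v
        show g v = v
        by_cases hv : v ∈ half c x i
        · by_cases hx : v = x
          · rw [hx, fix_root hT hg]
          · obtain ⟨j, hj, hvj⟩ := exists_half_child hT c hv hx
            exact hgJ j hj (Finset.notMem_empty j) v hvj
        · exact hg.2 v hv
      rw [this]
      exact one_mem K
    | insert j J hjJ ih =>
      intro g hg hgn hgJ
      by_cases hji : j = i
      · refine ih g hg hgn fun k hk hkJ => hgJ k hk ?_
        rw [Finset.mem_insert, not_or]
        exact ⟨fun h => hk (h.trans hji), hkJ⟩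
      have hball : ∀ v, T.dist v (c.step x j) ≤ ∑ j, n j → g v = v := by
        intro v hv
        refine hgn v ?_
        have := dist_step hT c v x j
        omega
      obtain ⟨p, hp, hpg⟩ := exists_restrict_half hT c F (x := c.step x j) (i := j) hg.1
        (hball _ (by rw [T.dist_self]; exact Nat.zero_le _))
        (by rw [c.step_step, fix_root hT hg])
      have hfix : ∀ v, g v = v → p v = v := by
        intro v hv
        by_cases h : v ∈ half c (c.step x j) j
        · rw [hpg v h, hv]
        · exact hp.2 v h
      have hpK : p ∈ K := hn j hji p hp fun v hv => hfix v (hball v (hv.trans (hle j)))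
      have hp' : p ∈ rist c F (half c x i) := rist_mono (half_child_subset hT c hji) hp
      have hfix' : ∀ v, g v = v → (g * p⁻¹) v = v := by
        intro v hv
        rw [mul_apply', inv_apply_eq_iff.2 (hfix v hv).symm, hv]
      have := ih (g * p⁻¹) (mul_mem hg (inv_mem hp')) (fun v hv => hfix' v (hgn v hv)) (by
        intro k hki hkJ v hv
        by_cases hkj : k = j
        · subst hkj
          rw [mul_apply', ← hpg _ ((apply_mem_iff_of_mem_rist (inv_mem hp)).2 hv),
            apply_inv_apply]
        · exact hfix' v (hgJ k hki (by simp [hkj, hkJ]) v hv))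
      have h2 := mul_mem this hpK
      rwa [inv_mul_cancel_right] at h2
  exact ⟨_, fun g hg hgn => key Finset.univ g hg hgn fun j _ hj =>
    absurd (Finset.mem_univ j) hj⟩

end full

section continuity

open scoped Pointwise

variable {c : Coloring T d} {F : Subgroup (Equiv.Perm (Fin d))}

/-! ### The countable index property -/

theorem exists_ball_of_level (hT : T.IsTree) (K : Subgroup (T ≃g T)) (x : V) (i : Fin d) (n : ℕ)
    (h : ∀ q ∈ level c x i n, ∃ n, ∀ g ∈ rist c F (half c q.1 q.2),
      (∀ v, T.dist v q.1 ≤ n → g v = v) → g ∈ K) :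
    ∃ n, ∀ g ∈ rist c F (half c x i), (∀ v, T.dist v x ≤ n → g v = v) → g ∈ K := by
  induction n with
  | zero => exact h (x, i) (Set.mem_singleton _)
  | succ n ih =>
    refine ih fun q hq => exists_ball_of_children hT K fun j hj => ?_
    exact h (c.step q.1 j, j) (child_mem_level hq hj)

/-- Density gives elements of `K` imitating any rotation below level `n`; fullness gives conjugators
in `K` on some half-tree `q` below each `p` of that level. The conclusion holds for `q`, climbs to
`p`, and then to the whole half-tree. -/
theorem exists_ball_of_countable_cover (hT : T.IsTree) (hd : 3 ≤ d) (hF : PointStabTransitive F)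
    {M : ℕ} (hM : ∀ (x : V) (i : Fin d), ∀ w ∈ rist c F (half c x i),
      w ∈ comms (rist c F (half c x i)) ^ M) (K : Subgroup (T ≃g T)) (S : ℕ → Set (T ≃g T))
    (hS : ∀ g ∈ universalGroupPlus c F, ∃ k, g ∈ S k)
    (hSK : ∀ k, ∀ y ∈ S k, ∀ z ∈ S k, y⁻¹ * z ∈ K) (x : V) (i : Fin d) :
    ∃ n, ∀ g ∈ rist c F (half c x i), (∀ v, T.dist v x ≤ n → g v = v) → g ∈ K := by
  have hpow : ∀ m, (K : Set (T ≃g T)) ^ m ⊆ K := by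
    intro m
    induction m with
    | zero => simp
    | succ m ih =>
      rw [pow_succ]
      rintro _ ⟨a, ha, b, hb, rfl⟩
      exact mul_mem (ih ha) hb
  obtain ⟨k, n, y, hyS, hyR, hy⟩ := exists_dense_piece hT c F (step_not_mem_half hT c x i) x S
    fun g hg => hS g (mem_universalGroupPlus_of_rist_half hT hg)
  refine exists_ball_of_level hT K x i n fun p hp => ?_
  obtain ⟨l, q, hq, t, ht⟩ := exists_full (F := F) hT hd p.1 p.2 S hS
  have hqK : ∃ n, ∀ g ∈ rist c F (half c q.1 q.2),
      (∀ v, T.dist v q.1 ≤ n → g v = v) → g ∈ K := by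
    obtain ⟨m, hm⟩ := exists_ball_subset_pow hT hd hF hM q.1 q.2 S K
      (fun g hg => hS g (mem_universalGroupPlus_of_rist_half hT hg)) (by
        intro k y hy z hz hyR hzR r hr
        obtain ⟨b', hb', b, hb, h⟩ := ht r hr
        rw [conj_eq_of_agree (mul_mem (inv_mem hyR) hzR) h]
        have h1 := hSK t b' hb' b hb
        exact mul_mem (mul_mem h1 (hSK k y hy z hz)) (inv_mem h1))
    exact ⟨m, fun g hg hgm => hpow _ (hm g hg hgm)⟩
  have hpfix : ∀ s ∈ rist c F (half c p.1 p.2), ∀ v, T.dist v x ≤ n → s v = v := by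
    intro s hs v hv
    by_cases hvp : v ∈ half c p.1 p.2
    · have h2 := dist_of_mem_level hT c hp hvp
      have h3 : v = p.1 := hT.connected.dist_eq_zero_iff.1 (by omega)
      rw [h3, fix_root hT hs]
    · exact hs.2 v hvp
  clear ht
  -- Climb from `q` to `p`: rotations approximated in `K` carry the result for one child to all its
  -- siblings, hence to their parent.
  induction l generalizing q with
  | zero => exact (show q = p from hq) ▸ hqK
  | succ l ih =>
    obtain ⟨q, hql, j, hj, rfl⟩ := hq
    refine ih q hql (exists_ball_of_children hT K fun j' hj' => ?_)
    obtain ⟨s, hs, hsj⟩ := exists_rotation hT hF c q.1 hj hj'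
    have hsp := rist_mono (level_half_subset hT c hql) hs
    -- The approximation need only be correct on the parent and its children, hence the radius
    -- `T.dist q.1 x + 1`.
    obtain ⟨z, hzS, hzR, hz⟩ := hy s (rist_mono (level_half_subset hT c hp) hsp) (hpfix s hsp)
      (T.dist q.1 x + 1)
    have hkU := (mul_mem (inv_mem hyR) hzR).1
    have hkK := hSK k y hyS z hzS
    set κ := y⁻¹ * z
    have hκq : κ q.1 = q.1 := by rw [hz _ (Nat.le_succ _), fix_root hT hs]
    have hκj : κ (c.step q.1 j) = c.step q.1 j' := by
      rw [hz, hsj]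
      have := dist_step hT c x q.1 j
      rw [T.dist_comm, T.dist_comm (u := q.1)]
      omega
    have hκq' : κ⁻¹ q.1 = q.1 := inv_apply_eq_iff.2 hκq.symm
    have hκj' : κ⁻¹ (c.step q.1 j') = c.step q.1 j := inv_apply_eq_iff.2 hκj.symm
    obtain ⟨m, hm⟩ := hqK
    refine ⟨m, fun g hg hgm => ?_⟩
    have h1 := hm _ (conj_mem_rist_child (inv_mem hkU) hκq' hκj' hg) (by
      intro v hv
      rw [inv_inv, mul_apply', mul_apply', hgm, inv_apply_apply]
      rw [← hκj]
      exact (dist_apply κ v (c.step q.1 j)).le.trans hv)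
    have h2 := mul_mem (mul_mem hkK h1) (inv_mem hkK)
    have h3 : κ * (κ⁻¹ * g * κ⁻¹⁻¹) * κ⁻¹ = g := by group
    rwa [h3] at h2

theorem mem_nhds_universalGroupPlus (hT : T.IsTree) (x : V)
    {U : Set (universalGroupPlus c F)} {n : ℕ}
    (h : ∀ g : universalGroupPlus c F, (∀ v, T.dist v x ≤ n → g.1 v = v) → g ∈ U) : U ∈ 𝓝 1 := by
  have h1 : {g : T ≃g T | ∀ v, T.dist v x ≤ n → g v = v} ∈
      𝓝 ((1 : universalGroupPlus c F) : T ≃g T) :=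
    (mem_nhds_iff_ball hT c x).2 ⟨n, fun _ hh => hh⟩
  exact Filter.mem_of_superset (continuous_subtype_val.continuousAt h1) fun g hg => h g hg

/-- A small element fixes the edge at `x` and splits over its two sides; this costs one product,
which is why `U * U` appears. -/
theorem mem_nhds_one_of_half (hT : T.IsTree) {x : V} {i : Fin d}
    {U U' : Set (universalGroupPlus c F)} (hU : U * U ⊆ U') (h : ∀ (x : V) (i : Fin d), ∃ n,
      ∀ g : universalGroupPlus c F, g.1 ∈ rist c F (half c x i) →
      (∀ v, T.dist v x ≤ n → g.1 v = v) → g ∈ U) : U' ∈ 𝓝 1 := by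
  obtain ⟨n, hn⟩ := h x i
  obtain ⟨m, hm⟩ := h (c.step x i) i
  refine mem_nhds_universalGroupPlus hT x (n := n + m + 1) fun g hg => hU ?_
  have hdist := dist_step hT c x x i
  rw [T.dist_self] at hdist
  obtain ⟨g₁, hg₁, g₂, hg₂, hg12, hfix⟩ := exists_split_edge hT (universalGroupPlus_le g.2)
    (hg x (by rw [T.dist_self]; omega)) (hg (c.step x i) (by rw [T.dist_comm]; omega))
  refine ⟨⟨g₂, mem_universalGroupPlus_of_rist_half hT hg₂⟩, hm _ hg₂ fun v hv => ?_,
    ⟨g₁, mem_universalGroupPlus_of_rist_half hT hg₁⟩, hn _ hg₁ fun v hv => ?_,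
    Subtype.ext hg12.symm⟩
  · refine (hfix v (hg v ?_)).2
    have := dist_step hT c v x i
    omega
  · exact (hfix v (hg v (by omega))).1

theorem countableIndexProperty (hT : T.IsTree) (hd : 3 ≤ d) (hF : PointStabTransitive F)
    {M : ℕ} (hM : ∀ (x : V) (i : Fin d), ∀ w ∈ rist c F (half c x i),
      w ∈ comms (rist c F (half c x i)) ^ M) :
    CountableIndexProperty (universalGroupPlus c F) := by
  intro K hK
  obtain ⟨x⟩ := hT.connected.nonempty
  obtain ⟨e, he⟩ := exists_surjective_nat (universalGroupPlus c F ⧸ K)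
  have h := exists_ball_of_countable_cover hT hd hF hM (K.map (universalGroupPlus c F).subtype)
    (fun k => {g | ∃ hg : g ∈ universalGroupPlus c F,
      ((⟨g, hg⟩ : universalGroupPlus c F) : universalGroupPlus c F ⧸ K) = e k})
    (fun g hg => by
      obtain ⟨k, hk⟩ := he ((⟨g, hg⟩ : universalGroupPlus c F) : universalGroupPlus c F ⧸ K)
      exact ⟨k, hg, hk.symm⟩)
    (by
      rintro k y ⟨hy, hyk⟩ z ⟨hz, hzk⟩
      exact ⟨_, QuotientGroup.eq.1 (hyk.trans hzk.symm), rfl⟩)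
  refine Subgroup.isOpen_of_mem_nhds K (g := 1) ?_
  refine mem_nhds_one_of_half hT (x := x) (i := ⟨0, by omega⟩) (U := K)
    (by simp) fun x i => ?_
  obtain ⟨n, hn⟩ := h x i
  refine ⟨n, fun g hg hgn => ?_⟩
  obtain ⟨k, hk, hkg⟩ := hn g.1 hg hgn
  exact Subtype.ext hkg ▸ hk

/-! ### Automatic continuity -/

theorem coe_mem_of_map_mem {H : Type*} [Group H] {ψ : universalGroupPlus c F →* H} {N : Set H}
    {g : universalGroupPlus c F} (h : ψ g ∈ N) :
    (g : T ≃g T) ∈ {g : T ≃g T | ∃ hg : g ∈ universalGroupPlus c F, ψ ⟨g, hg⟩ ∈ N} :=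
  ⟨g.2, h⟩

theorem mem_pow_of_mem_pow {H : Type*} [Group H]
    (ψ : universalGroupPlus c F →* H) (N : Set H) (m : ℕ) :
    ∀ {g : T ≃g T}, g ∈ {g : T ≃g T | ∃ hg : g ∈ universalGroupPlus c F, ψ ⟨g, hg⟩ ∈ N} ^ m →
      ∃ hg : g ∈ universalGroupPlus c F, ψ ⟨g, hg⟩ ∈ N ^ m := by
  induction m with
  | zero =>
    intro g hg
    rw [pow_zero, Set.mem_one] at hg
    subst hg
    refine ⟨one_mem _, ?_⟩
    rw [pow_zero, Set.mem_one]
    exact map_one ψ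
  | succ m ih =>
    rw [pow_succ]
    rintro _ ⟨a, ha, b, ⟨hb, hbN⟩, rfl⟩
    obtain ⟨ha', haN⟩ := ih ha
    refine ⟨mul_mem ha' hb, ?_⟩
    rw [pow_succ]
    exact ⟨_, haN, _, hbN, (map_mul ψ ⟨a, ha'⟩ ⟨b, hb⟩).symm⟩

variable {H : Type*} [Group H] [TopologicalSpace H] [IsTopologicalGroup H]

theorem exists_nhds_one_pow_subset (n : ℕ) :
    ∀ N ∈ 𝓝 (1 : H), ∃ W ∈ 𝓝 (1 : H), W ^ n ⊆ N := by
  induction n with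
  | zero =>
    intro N hN
    refine ⟨N, hN, ?_⟩
    rw [pow_zero, Set.one_subset]
    exact mem_of_mem_nhds hN
  | succ n ih =>
    intro N hN
    obtain ⟨W, hW, hWN⟩ := exists_nhds_one_split hN
    obtain ⟨W', hW', hWW⟩ := ih W hW
    refine ⟨W ∩ W', Filter.inter_mem hW hW', ?_⟩
    rw [pow_succ]
    rintro _ ⟨a, ha, b, hb, rfl⟩
    exact hWN a (hWW (Set.pow_subset_pow_left Set.inter_subset_right ha)) b hb.1

theorem exists_denseSeq_mul_mem [TopologicalSpace.SeparableSpace H] {W : Set H} (hW : W ∈ 𝓝 (1 : H)) (h : H) :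
    ∃ k, (TopologicalSpace.denseSeq H k)⁻¹ * h ∈ W := by
  have h1 : {y : H | y⁻¹ * h ∈ W} ∈ 𝓝 h := by
    have : Filter.Tendsto (fun y : H => y⁻¹ * h) (𝓝 h) (𝓝 (h⁻¹ * h)) :=
      Filter.Tendsto.mul_const h (Filter.Tendsto.inv Filter.tendsto_id)
    rw [inv_mul_cancel] at this
    exact this hW
  obtain ⟨y, hy, k, rfl⟩ := mem_closure_iff_nhds.1 (TopologicalSpace.denseRange_denseSeq H h) _ h1
  exact ⟨k, hy⟩

/-- Continuity at the identity of the restriction of a homomorphism to the rigid stabilizer of a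
half-tree. -/
def ContinuousOnHalf (ψ : universalGroupPlus c F →* H) (x : V) (i : Fin d) : Prop :=
  ∀ N ∈ 𝓝 (1 : H), ∃ n, ∀ g : universalGroupPlus c F, g.1 ∈ rist c F (half c x i) →
    (∀ v, T.dist v x ≤ n → g.1 v = v) → ψ g ∈ N

theorem continuous_of_continuousOnHalf (hT : T.IsTree) (hd : 3 ≤ d)
    {ψ : universalGroupPlus c F →* H} (h : ∀ x i, ContinuousOnHalf ψ x i) : Continuous ψ := by
  obtain ⟨x⟩ := hT.connected.nonempty
  refine continuous_of_continuousAt_one ψ ?_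
  intro N hN
  rw [map_one] at hN
  obtain ⟨W, hW, hWN⟩ := exists_nhds_one_split hN
  refine mem_nhds_one_of_half hT (x := x) (i := ⟨0, by omega⟩) (U := ψ ⁻¹' W) ?_ fun x i =>
    h x i W hW
  rintro _ ⟨a, ha, b, hb, rfl⟩
  show ψ (a * b) ∈ N
  rw [map_mul]
  exact hWN _ ha _ hb

/-- The hypothesis says that conjugation by images of R is equicontinuous at 1 on the image of R.
The pieces are preimages of translates of a small set along a dense sequence in `H`. -/
theorem continuousOnHalf_of_conj [TopologicalSpace.SeparableSpace H] (hT : T.IsTree) (hd : 3 ≤ d)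
    (hF : PointStabTransitive F)
    {M : ℕ} (hM : ∀ (x : V) (i : Fin d), ∀ w ∈ rist c F (half c x i),
      w ∈ comms (rist c F (half c x i)) ^ M) (ψ : universalGroupPlus c F →* H) (x : V) (i : Fin d)
    (h : ∀ N ∈ 𝓝 (1 : H), ∃ W ∈ 𝓝 (1 : H), ∀ r y : universalGroupPlus c F,
      r.1 ∈ rist c F (half c x i) → y.1 ∈ rist c F (half c x i) → ψ y ∈ W →
        ψ (r * y * r⁻¹) ∈ N) : ContinuousOnHalf ψ x i := by
  intro N hN
  -- The exponent is known before the cover is chosen, so `N₁` can be shrunk to absorb it.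
  obtain ⟨N₁, hN₁, hN₁N⟩ := exists_nhds_one_pow_subset (4 * M * d) N hN
  obtain ⟨W, hW, hWN⟩ := h N₁ hN₁
  obtain ⟨W₁, hW₁, hW₁W⟩ : ∃ W₁ ∈ 𝓝 (1 : H), ∀ a ∈ W₁, ∀ b ∈ W₁, a⁻¹ * b ∈ W := by
    obtain ⟨W₁, hW₁, h1⟩ := exists_nhds_one_split hW
    refine ⟨W₁ ∩ W₁⁻¹, Filter.inter_mem hW₁ (inv_mem_nhds_one H hW₁), fun a ha b hb => ?_⟩
    exact h1 _ ha.2 _ hb.1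
  have hmem : ∀ {g : T ≃g T}, g ∈ rist c F (half c x i) → g ∈ universalGroupPlus c F :=
    fun hg => mem_universalGroupPlus_of_rist_half hT hg
  obtain ⟨n, hn⟩ := exists_ball_subset_pow hT hd hF hM x i
    (fun k => {g | ∃ hg : g ∈ universalGroupPlus c F,
      (TopologicalSpace.denseSeq H k)⁻¹ * ψ ⟨g, hg⟩ ∈ W₁})
    {g | ∃ hg : g ∈ universalGroupPlus c F, ψ ⟨g, hg⟩ ∈ N₁}
    (fun g hg => by
      obtain ⟨k, hk⟩ := exists_denseSeq_mul_mem hW₁ (ψ ⟨g, hmem hg⟩)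
      exact ⟨k, hmem hg, hk⟩)
    (by
      rintro k y ⟨hy, hyk⟩ z ⟨hz, hzk⟩ hyR hzR r hr
      have hr' := hmem hr
      lift y to universalGroupPlus c F using hy
      lift z to universalGroupPlus c F using hz
      lift r to universalGroupPlus c F using hr'
      have h1 : ψ (y⁻¹ * z) ∈ W := by
        have h2 := hW₁W _ hyk _ hzk
        rwa [mul_inv_rev, inv_inv, mul_assoc, mul_inv_cancel_left, ← map_inv, ← map_mul] at h2
      have h2 : ((y⁻¹ * z : universalGroupPlus c F) : T ≃g T) ∈ rist c F (half c x i) := by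
        rw [Subgroup.coe_mul, Subgroup.coe_inv]
        exact mul_mem (inv_mem hyR) hzR
      have h3 := coe_mem_of_map_mem (hWN r (y⁻¹ * z) hr h2 h1)
      rwa [Subgroup.coe_mul, Subgroup.coe_mul, Subgroup.coe_mul, Subgroup.coe_inv,
        Subgroup.coe_inv] at h3)
  refine ⟨n, fun g hg hgn => hN₁N ?_⟩
  exact (mem_pow_of_mem_pow ψ N₁ _ (hn g.1 hg hgn)).2

theorem ContinuousOnHalf.rotate (hT : T.IsTree) (hd : 3 ≤ d) (hF : PointStabTransitive F)
    {ψ : universalGroupPlus c F →* H} {x : V} {i : Fin d} (h : ContinuousOnHalf ψ x i)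
    (j : Fin d) : ContinuousOnHalf ψ x j := by
  obtain ⟨k, hki, hkj⟩ := exists_ne_ne hd i j
  -- Fixing an edge of a third color `k` puts the rotation in U(F)⁺, so that ψ is defined on it.
  obtain ⟨s, hs, hsj⟩ := exists_rotation hT hF c x hkj.symm hki.symm (i := k)
  have hsx := fix_root hT hs
  have hla : localAction c s x j = i := by
    apply c.step_injective x
    rw [← hsj, apply_step, hsx]
  intro N hN
  let σ : universalGroupPlus c F := ⟨s, mem_universalGroupPlus_of_rist_half hT hs⟩
  have hN' : {y : H | (ψ σ)⁻¹ * y * ψ σ ∈ N} ∈ 𝓝 (1 : H) := by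
    have hcont : Continuous fun y : H => (ψ σ)⁻¹ * y * ψ σ := by fun_prop
    refine hcont.continuousAt ?_
    simpa using hN
  obtain ⟨n, hn⟩ := h _ hN'
  refine ⟨n, fun g hg hgn => ?_⟩
  have h1 := hn (σ * g * σ⁻¹) (conj_mem_rist_half hs.1 hsx hla hg) (by
    intro v hv
    show (s * g.1 * s⁻¹) v = v
    rw [mul_apply', mul_apply', hgn, apply_inv_apply]
    have := dist_apply s (s⁻¹ v) x
    rw [apply_inv_apply, hsx] at this
    exact this.symm.le.trans hv)
  have h2 : (ψ σ)⁻¹ * ψ (σ * g * σ⁻¹) * ψ σ = ψ g := by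
    rw [map_mul, map_mul, map_inv]
    group
  rw [← h2]
  exact h1

/-- Rotation changes the color at a fixed vertex; crossing an edge uses that continuity passes to a
smaller half-tree, with the radius enlarged by one. -/
theorem ContinuousOnHalf.all (hT : T.IsTree) (hd : 3 ≤ d) (hF : PointStabTransitive F)
    {ψ : universalGroupPlus c F →* H} {x : V} {i : Fin d} (h : ContinuousOnHalf ψ x i)
    (y : V) (j : Fin d) : ContinuousOnHalf ψ y j := by
  suffices h1 : ∀ y, ∀ j, ContinuousOnHalf ψ y j from h1 y j
  intro y
  refine induction_on_step hT c x (P := fun y => ∀ j, ContinuousOnHalf ψ y j)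
    (fun j => h.rotate hT hd hF j) (fun y k hy j => ?_) y
  refine ContinuousOnHalf.rotate hT hd hF (i := k) ?_ j
  obtain ⟨l, hl, _⟩ := exists_ne_ne hd k k
  intro N hN
  obtain ⟨n, hn⟩ := hy l N hN
  refine ⟨n + 1, fun g hg hgn =>
    hn g (rist_mono (half_child_subset hT c hl.symm) hg) fun v hv => hgn v ?_⟩
  have := dist_step hT c v y k
  omega

theorem continuous_of_locallyCompact [TopologicalSpace.SeparableSpace H] [LocallyCompactSpace H] (hT : T.IsTree)
    (hd : 3 ≤ d) (hF : PointStabTransitive F)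
    {M : ℕ} (hM : ∀ (x : V) (i : Fin d), ∀ w ∈ rist c F (half c x i),
      w ∈ comms (rist c F (half c x i)) ^ M) (ψ : universalGroupPlus c F →* H) :
    Continuous ψ := by
  obtain ⟨x⟩ := hT.connected.nonempty
  obtain ⟨U, hU, hU1⟩ := exists_compact_mem_nhds (1 : H)
  obtain ⟨_, q, _, k, hk⟩ := exists_full (c := c) (F := F) hT hd x ⟨0, by omega⟩
    (fun k => {g | ∃ hg : g ∈ universalGroupPlus c F,
      (TopologicalSpace.denseSeq H k)⁻¹ * ψ ⟨g, hg⟩ ∈ U})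
    (fun g hg => by
      obtain ⟨k, hk⟩ := exists_denseSeq_mul_mem hU1 (ψ ⟨g, hg⟩)
      exact ⟨k, hg, hk⟩)
  refine continuous_of_continuousOnHalf hT hd fun y j =>
    ContinuousOnHalf.all hT hd hF (x := q.1) (i := q.2) ?_ y j
  refine continuousOnHalf_of_conj hT hd hF hM ψ q.1 q.2 fun N hN => ?_
  -- Conjugation by a compact set is equicontinuous at 1. By fullness, the conjugator `r` can be
  -- replaced by b'⁻¹b, whose image lies in U⁻¹U because the dense-sequence factor cancels.
  have hev : ∀ᶠ y in 𝓝 (1 : H), ∀ a ∈ U⁻¹ * U, a * y * a⁻¹ ∈ N := by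
    refine (hU.inv.mul hU).eventually_forall_of_forall_eventually fun a _ => ?_
    have hcont : Continuous fun z : H × H => z.2 * z.1 * z.2⁻¹ := by fun_prop
    have h1 : N ∈ 𝓝 (a * 1 * a⁻¹) := by simpa using hN
    exact (hcont.tendsto (1, a)).eventually h1
  refine ⟨_, hev, fun r y hr hy hyW => ?_⟩
  obtain ⟨b', ⟨hb', hb'U⟩, b, ⟨hb, hbU⟩, hbr⟩ := hk r.1 hr
  have h1 : r * y * r⁻¹ = (⟨b', hb'⟩⁻¹ * ⟨b, hb⟩) * y * (⟨b', hb'⟩⁻¹ * ⟨b, hb⟩)⁻¹ :=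
    Subtype.ext (conj_eq_of_agree hy hbr)
  rw [h1, map_mul, map_mul ψ _ y, map_inv]
  refine hyW _ ⟨_, Set.inv_mem_inv.2 hb'U, _, hbU, ?_⟩
  rw [map_mul, map_inv]
  group

end continuity

end BurgerMozes

theorem mainTheorem5 {V : Type u} (T : SimpleGraph V) (hT : T.IsTree)
    (d : ℕ) (hd : 6 ≤ d) (c : BurgerMozes.Coloring T d)
    (F : Subgroup (Equiv.Perm (Fin d)))
    (hF_perfect : Group.IsPerfect F)
    (hF_twoTransitive : MulAction.IsMultiplyPretransitive F (Fin d) 2)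
    (hF_generated : (⨆ i : Fin d, MulAction.stabilizer F i) = (⊤ : Subgroup F))
    (hF_stabilizers : ∀ i : Fin d, Group.IsPerfect (MulAction.stabilizer F i)) :
    CountableIndexProperty (BurgerMozes.universalGroupPlus c F) ∧
      InvariantAutomaticContinuityProperty.{u, v} (BurgerMozes.universalGroupPlus c F) ∧
      LocallyCompactAutomaticContinuityProperty.{u, v} (BurgerMozes.universalGroupPlus c F) := by
  have hd3 : 3 ≤ d := le_trans (by norm_num) hd
  have hF := BurgerMozes.pointStabTransitive_of_isMultiplyPretransitive hF_twoTransitive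
  obtain ⟨M, hM⟩ := BurgerMozes.exists_comms_pow_rist_half hT c hd3 hF hF_stabilizers
  refine ⟨BurgerMozes.countableIndexProperty hT hd3 hF hM, ?_, ?_⟩
  · intro H _ _ _ _ hSIN ψ
    refine BurgerMozes.continuous_of_continuousOnHalf hT hd3 fun x i =>
      BurgerMozes.continuousOnHalf_of_conj hT hd3 hF hM ψ x i fun N hN => ?_
    -- For an invariant neighborhood the conjugation condition is immediate, on every half-tree.
    obtain ⟨W, hW, hWN, hWconj⟩ := hSIN N hN
    refine ⟨W, hW, fun r y _ _ hy => hWN ?_⟩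
    rw [map_mul, map_mul, map_inv]
    exact hWconj _ _ hy
  · intro H _ _ _ _ _ ψ
    exact BurgerMozes.continuous_of_locallyCompact hT hd3 hF hM ψ
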